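/- Let $d\ge 1$, $a<b$, $\beta>0$, and let $\omega=(\omega_t)_{t\in[a,b]}$ be a stochastic process with values in $\mathbb{R}^d$ and continuous paths. Let $\nu_{st}$ be the law of $\omega_t-\omega_s$, and let $\|\nu_{st}\|_{C^\beta}$ be the Hölder norm of its Lebesgue density ($+\infty$ if there is no density of class $C^\beta$). Assume that there is $C_\nu\ge 0$ such that for every interval $J\subseteq[a,b]$ $$\iint_{J\times J}\|\nu_{st}\|_{C^\beta}\,ds\,dt\le C_\nu|J|.$$ Let $\mu_{a,t}(A)=\int_a^t \mathbf 1_A(\omega_r)\,dr$ be the occupation measure. For a finite (signed) measure $\mu$ let $F_\mu(r,y)=\mu(\{x:|x-y|\le r\})$, let $\Delta_0F(r)=F(r)-F(r/2)$, $\Delta_{k+1}F(r)=\Delta_kF(r)-2^{k+1}\Delta_kF(r/2)$, and for $\alpha>0$, $k=\lceil\alpha+d-1\rceil$, let $$\|\mu\|_{\mathrm{SBE}^{\alpha,2}_2}=\big\|r^{-\alpha-d}(\Delta_k)_rF_\mu(r,y)\big\|_{L^2_yL^2_r(\mathbb{R}^d\times(0,\infty),\,dy\otimes\frac{dr}{r})};$$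 $\mathrm{SBE}^{\alpha,2}_2$ consists of the compactly supported $\mu$ for which this is finite. Let $$\|\mu_{a,\cdot}\|_{V^2(\mathrm{SBE}^{\alpha,2}_2)}=\Big(\sup_{a=t_0<\dots<t_n=b}\ \sum_{h=1}^n\|\mu_{a,t_h}-\mu_{a,t_{h-1}}\|_{\mathrm{SBE}^{\alpha,2}_2}^2\Big)^{1/2}.$$ Then for every $0<\alpha<\beta/2$ with $2\alpha\notin\mathbb{N}$, the $V^2(\mathrm{SBE}^{\alpha,2}_2)$ norm of $\mu_{a,\cdot}$ is ($\mathbb{P}$-almost everywhere) measurable, and almost surely $\mu_{a,\cdot}\in V^2(\mathrm{SBE}^{\alpha,2}_2)$, that is, $\mu_{a,t}\in\mathrm{SBE}^{\alpha,2}_2$ for all $t\in[a,b]$ and the norm is finite. More precisely, for every $0<\delta<\delta_0:=\frac{\beta-2\alpha}{\beta+2d}$ and every $1\le q<2$ there is a constant $K>0$, depending only on $d,a,b,\alpha,\beta,\delta,q$ (and not on $\omega$, its probability space, or $C_\nu$), such that $$\mathbb{E}\Big[\|\mu_{a,\cdot}\|_{V^2(\mathrm{SBE}^{\alpha,2}_2)}^q\,\big(1+\sup_{s\in[a,b]}|\omega_s|\big)^{-d}\Big]\le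 K\big(1+C_\nu^{(1-\delta)q/2}\big).$$ -/

import Mathlib

open MeasureTheory Set
open scoped ENNReal

noncomputable section

namespace SmallBall

/-- The space `ℝ^d` with its Euclidean norm. -/
abbrev Rd (d : ℕ) : Type := EuclideanSpace ℝ (Fin d)

/-- The operators `Δ_k`: `Δ_0 F(r) = F(r) - F(r/2)` and
`Δ_{k+1} F(r) = Δ_k F(r) - 2^(k+1) Δ_k F(r/2)`. -/
def scaleDiff : ℕ → (ℝ → ℝ) → ℝ → ℝ
  | 0, F, r => F r - F (r / 2)
  | k + 1, F, r => scaleDiff k F r - 2 ^ (k + 1) * scaleDiff k F (r / 2)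

/-- The measure `dr / r` on `(0, ∞)`. -/
def drOverR : Measure ℝ :=
  (volume.restrict (Ioi (0 : ℝ))).withDensity fun r => ENNReal.ofReal r⁻¹

/-- `F_μ(r, y)`: the `μ`-mass of the closed ball of radius `r` centred at `y`. -/
def ballMass {d : ℕ} (μ : SignedMeasure (Rd d)) (r : ℝ) (y : Rd d) : ℝ :=
  μ (Metric.closedBall y r)

/-- The small ball norm `‖ r^(-α-d) (Δ_k)_r F_μ(r, y) ‖` in `L^q_y L^p_r`
(the inner norm is in `r`, with respect to `dr / r`, the outer one in `y`), with
`k = ⌈α + d - 1⌉`.  It takes the value `∞` when this norm is not finite. -/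
def sbeNorm {d : ℕ} (α : ℝ) (p q : ℝ≥0∞) (μ : SignedMeasure (Rd d)) : ℝ≥0∞ :=
  eLpNorm
    (fun y : Rd d =>
      eLpNorm
        (fun r : ℝ =>
          r ^ (-α - (d : ℝ)) * scaleDiff ⌈α + (d : ℝ) - 1⌉₊ (fun ρ => ballMass μ ρ y) r)
        p drOverR)
    q volume

/-- The measure `μ` vanishes outside some compact set. -/
def HasCompactSupp {d : ℕ} (μ : SignedMeasure (Rd d)) : Prop :=
  ∃ K : Set (Rd d), IsCompact K ∧ ∀ A : Set (Rd d), MeasurableSet A → Disjoint A K → μ A = 0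

/-- `μ` satisfies a small ball estimate of regularity `α`, integrability `p`, and values
in `L^q`: it is compactly supported with finite small ball norm. -/
def MemSBE {d : ℕ} (α : ℝ) (p q : ℝ≥0∞) (μ : SignedMeasure (Rd d)) : Prop :=
  HasCompactSupp μ ∧ sbeNorm α p q μ < ∞

/-- The `p`-variation over `[a, b]` of a path `f` with values in a group whose size is
measured by `N`:
`(sup ∑ N (f (t_{i+1}) - f (t_i)) ^ p) ^ (1 / p)` over partitions `a = t_0 < ... < t_n = b`. -/
def variationNorm {M : Type*} [AddCommGroup M] (N : M → ℝ≥0∞) (p a b : ℝ) (f : ℝ → M) :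
    ℝ≥0∞ :=
  (⨆ (n : ℕ) (t : Fin (n + 1) → ℝ) (_ : StrictMono t ∧ t 0 = a ∧ t (Fin.last n) = b),
    ∑ i : Fin n, N (f (t i.succ) - f (t i.castSucc)) ^ p) ^ (1 / p)

/-- The `V^e(SBE^{α,p}_q)` norm, over `[a, b]`, of a measure-valued path. -/
def variationSBENorm {d : ℕ} (e α : ℝ) (p q : ℝ≥0∞) (a b : ℝ)
    (f : ℝ → SignedMeasure (Rd d)) : ℝ≥0∞ :=
  variationNorm (sbeNorm α p q) e a b f

/-- The measure-valued path `f` belongs to `V^e(SBE^{α,p}_q)` over `[a, b]`. -/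
def MemVariationSBE {d : ℕ} (e α : ℝ) (p q : ℝ≥0∞) (a b : ℝ)
    (f : ℝ → SignedMeasure (Rd d)) : Prop :=
  (∀ t ∈ Icc a b, MemSBE α p q (f t)) ∧ variationSBENorm e α p q a b f < ∞

/-- The occupation measure `μ_{s,t}(A) = |{r ∈ (s, t] : w r ∈ A}|` of a path `w`. -/
def occupation {d : ℕ} (w : ℝ → Rd d) (s t : ℝ) : SignedMeasure (Rd d) :=
  ((volume.restrict (Ioc s t)).map w).toSignedMeasure

open Classical in
/-- The Hölder norm `‖f‖_{C^β}` on `ℝ^d`: with `m = ⌊β⌋`, the sum of the sup norms of the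
derivatives of order at most `m` and of the `(β - m)`-Hölder seminorm of the derivative of
order `m`; it is `∞` if `f` is not of class `C^m`. For integer `β` the last term
is the oscillation of the derivative of order `β`, so that the norm is equivalent
to the usual one of `C^β`. -/
def holderNorm {d : ℕ} (β : ℝ) (f : Rd d → ℝ) : ℝ≥0∞ :=
  if ContDiff ℝ (⌊β⌋₊ : ℕ) f then
    (∑ j ∈ Finset.range (⌊β⌋₊ + 1), ⨆ x : Rd d, ‖iteratedFDeriv ℝ j f x‖ₑ) +
      ⨆ (x : Rd d) (y : Rd d) (_ : x ≠ y),
        ‖iteratedFDeriv ℝ ⌊β⌋₊ f x - iteratedFDeriv ℝ ⌊β⌋₊ f y‖ₑ /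
          ‖x - y‖ₑ ^ (β - (⌊β⌋₊ : ℝ))
  else ∞

/-- `‖ν‖_{C^β}` for a positive measure `ν`: the Hölder norm of its Lebesgue density, and `∞` if
there is no density of class `C^β` (such a density is continuous, hence unique). -/
def measureHolderNorm {d : ℕ} (β : ℝ) (ν : Measure (Rd d)) : ℝ≥0∞ :=
  ⨅ (f : Rd d → ℝ) (_ : 0 ≤ f ∧ Measurable f ∧
    ν = volume.withDensity fun x => ENNReal.ofReal (f x)), holderNorm β f

/-- `(ω_t)_{t ∈ [a,b]}` is a stochastic process with (almost surely) continuous paths. -/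
def IsContinuousProcess {d : ℕ} {Ω : Type*} [MeasurableSpace Ω] (P : Measure Ω) (a b : ℝ)
    (ω : ℝ → Ω → Rd d) : Prop :=
  (∀ t ∈ Icc a b, Measurable (ω t)) ∧ ∀ᵐ x ∂P, ContinuousOn (fun t => ω t x) (Icc a b)

/-- `∬_{J × J} ‖ν_{st}‖_{C^β} ds dt ≤ C |J|` for every interval `J ⊆ [a,b]`, with `ν_{st}` the
law of the increment `ω_t - ω_s`. -/
def IncrementLawBound {d : ℕ} {Ω : Type*} [MeasurableSpace Ω] (P : Measure Ω) (a b : ℝ)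
    (ω : ℝ → Ω → Rd d) (β C : ℝ) : Prop :=
  ∀ c e : ℝ, a ≤ c → c ≤ e → e ≤ b →
    ∫⁻ z in Icc c e ×ˢ Icc c e, measureHolderNorm β (P.map fun x => ω z.2 x - ω z.1 x)
      ≤ ENNReal.ofReal (C * (e - c))

end SmallBall

end

/-! For the occupation measure of `w` on `(s, t]`, `(Δ_k)_r F(r, y)` is `∫ φ_r(w u - y) du` over
`(s, t]`, where `φ_r` (`ballKernel`) is `Δ_k` applied to the indicator of the ball. As both
exponents are 2, the `L²_y` norm can be squared and expanded: it is the double time integral of the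
autocorrelation of `φ_r` (`ballCorr`) at `w v - w u`, and its expectation only involves the laws of
increments.

If `k ≥ d + ⌊β⌋`, then `Δ_k` annihilates what a Taylor polynomial of degree `⌊β⌋` contributes to
ball averages, so a `C^β` density integrates `φ_r` to order `r^(d+β)`. The other copy of `φ_r`
contributes its `L¹` norm, of order `r^d`. Hence `E ∫ |Δ_k F|² dy ≲ r^(2d+β) Cν (t - s)`
(`lintegral_lintegral_sq_occDiff_le`), while pathwise `∫ |Δ_k F|² dy ≲ r^d (t - s)²`. Taking the
powers `1 - δ` and `δ` of these bounds for `r ≤ 1`, and the second alone for `r > 1`, the integral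
in `r` converges and gives `E ‖μ_{s,t}‖² ≲ (1 + Cν^(1-δ)) (t - s)^(1+δ)`
(`exists_lintegral_occNorm_sq_le`).

The norm uses `k = ⌈α + d - 1⌉`, which may be too small for this cancellation. A Hardy-type
absorption argument bounds the norm with `Δ_k` by that with `Δ_(k+1)` as long as `α + d < k + 1`
(`eLpNorm_scaleDiff_le_succ`); strictness is where `2α ∉ ℕ` enters.

The exponent `1 + δ > 1` controls the supremum over all partitions by dyadic chaining
(`sum_sq_le_tsum_dyadic`): an interval is filled by at most two dyadic intervals per level, and a
dyadic interval is used by at most one interval of the partition. This bounds the expected square of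
the variation norm; Jensen's inequality gives the moments of order `q < 2`, and the weight, being at
most 1, is discarded. -/

namespace SmallBall

/-! ### The operators `Δ_k` -/

/-- The coefficients of `Δ_k F(r)` as a combination of the values `F(r / 2^j)`. -/
noncomputable def scaleDiffCoeff : ℕ → ℕ → ℝ
  | 0, 0 => 1
  | 0, 1 => -1
  | 0, _ + 2 => 0
  | k + 1, 0 => scaleDiffCoeff k 0
  | k + 1, j + 1 => scaleDiffCoeff k (j + 1) - 2 ^ (k + 1) * scaleDiffCoeff k j

lemma scaleDiffCoeff_eq_zero (k j : ℕ) (h : k + 2 ≤ j) : scaleDiffCoeff k j = 0 := by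
  induction k generalizing j with
  | zero =>
    obtain ⟨j, rfl⟩ := Nat.exists_eq_add_of_le' h
    rfl
  | succ k ih =>
    obtain ⟨j, rfl⟩ : ∃ i, j = i + 1 := ⟨j - 1, by omega⟩
    simp [scaleDiffCoeff, ih (j + 1) (by omega), ih j (by omega)]

lemma scaleDiff_eq_sum (k : ℕ) (F : ℝ → ℝ) (r : ℝ) :
    scaleDiff k F r = ∑ j ∈ Finset.range (k + 2), scaleDiffCoeff k j * F (r / 2 ^ j) := by
  induction k generalizing r with
  | zero => simp [scaleDiff, scaleDiffCoeff, Finset.sum_range_succ, sub_eq_add_neg]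
  | succ k ih =>
    have h : ∀ j : ℕ, r / 2 / 2 ^ j = r / 2 ^ (j + 1) := fun j => by
      rw [pow_succ, div_div, mul_comm]
    have h1 : ∑ j ∈ Finset.range (k + 2), scaleDiffCoeff k j * F (r / 2 ^ j)
        = ∑ j ∈ Finset.range (k + 2), scaleDiffCoeff k (j + 1) * F (r / 2 ^ (j + 1))
          + scaleDiffCoeff k 0 * F r := by
      rw [Finset.sum_range_succ', Finset.sum_range_succ _ (k + 1),
        scaleDiffCoeff_eq_zero k (k + 1 + 1) le_rfl]
      simp
    rw [scaleDiff, ih, ih, Finset.sum_range_succ' _ (k + 2), h1, Finset.mul_sum]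
    simp only [scaleDiffCoeff, sub_mul, Finset.sum_sub_distrib, h, mul_assoc, pow_zero, div_one]
    ring

/-- Monomials are eigenfunctions of every stage, and stage `l = i` has eigenvalue zero. So `Δ_k`
kills the degrees `0, ..., k`. -/
lemma scaleDiff_pow (k i : ℕ) (r : ℝ) :
    scaleDiff k (fun ρ => ρ ^ i) r
      = (∏ l ∈ Finset.range (k + 1), (1 - 2 ^ l / 2 ^ i)) * r ^ i := by
  induction k generalizing r with
  | zero => simp [scaleDiff, div_pow]; ring
  | succ k ih =>
    rw [scaleDiff, ih, ih, Finset.prod_range_succ _ (k + 1), div_pow]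
    ring

lemma sum_scaleDiffCoeff_mul_pow (k i : ℕ) (hi : i ≤ k) (r : ℝ) :
    ∑ j ∈ Finset.range (k + 2), scaleDiffCoeff k j * (r / 2 ^ j) ^ i = 0 := by
  rw [← scaleDiff_eq_sum k (fun ρ => ρ ^ i), scaleDiff_pow,
    Finset.prod_eq_zero (i := i) (Finset.mem_range.2 (by omega)), zero_mul]
  simp

/-- The `ℓ¹` norm of the coefficients of `Δ_k`. -/
noncomputable def scaleDiffBound (k : ℕ) : ℝ :=
  ∑ j ∈ Finset.range (k + 2), |scaleDiffCoeff k j|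

lemma scaleDiffBound_nonneg (k : ℕ) : 0 ≤ scaleDiffBound k :=
  Finset.sum_nonneg fun _ _ => abs_nonneg _

lemma scaleDiffBound_pos (k : ℕ) : 0 < scaleDiffBound k := by
  have h : scaleDiffCoeff k 0 = 1 := by
    induction k with
    | zero => rfl
    | succ k ih => exact ih
  refine Finset.sum_pos' (fun _ _ => abs_nonneg _) ⟨0, by simp, by simp [h]⟩

lemma abs_sum_scaleDiffCoeff_le (k : ℕ) (a : ℕ → ℝ) (M : ℝ) (h : ∀ j, |a j| ≤ M) :
    |∑ j ∈ Finset.range (k + 2), scaleDiffCoeff k j * a j| ≤ scaleDiffBound k * M := by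
  rw [scaleDiffBound, Finset.sum_mul]
  refine (Finset.abs_sum_le_sum_abs _ _).trans (Finset.sum_le_sum fun j _ => ?_)
  rw [abs_mul]
  gcongr
  exact h j

lemma abs_scaleDiff_le (k : ℕ) (F : ℝ → ℝ) (r M : ℝ) (h : ∀ j : ℕ, |F (r / 2 ^ j)| ≤ M) :
    |scaleDiff k F r| ≤ scaleDiffBound k * M := by
  rw [scaleDiff_eq_sum]
  exact abs_sum_scaleDiffCoeff_le k _ M h

/-! ### Taylor approximation along rays -/

/-- Induction on the order: integrate the approximation of `deriv g` by the mean value inequality.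
The coefficients stay anonymous because `Δ_k` will kill the polynomial, and the sharper factor `1 /
m!` is not needed. -/
lemma exists_poly_approx (m : ℕ) (g : ℝ → ℝ) (hg : ContDiff ℝ m g) (L R : ℝ)
    (hL : ∀ τ ∈ Icc 0 R, |iteratedDeriv m g τ - iteratedDeriv m g 0| ≤ L) :
    ∃ p : ℕ → ℝ, ∀ ρ ∈ Icc 0 R, |g ρ - ∑ i ∈ Finset.range (m + 1), p i * ρ ^ i| ≤ L * ρ ^ m := by
  induction m generalizing g with
  | zero => exact ⟨fun _ => g 0, fun ρ hρ => by simpa using hL ρ hρ⟩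
  | succ m ih =>
    have hg' : ContDiff ℝ m (deriv g) := by
      have := (contDiff_succ_iff_deriv (n := (m : WithTop ℕ∞))).1 (by exact_mod_cast hg)
      exact this.2.2
    have hd : Differentiable ℝ g := hg.differentiable (by simp)
    obtain ⟨p, hp⟩ := ih (deriv g) hg' (by simpa only [iteratedDeriv_succ'] using hL)
    refine ⟨fun i => if i = 0 then g 0 else p (i - 1) / i, fun ρ hρ => ?_⟩
    have hL0 : 0 ≤ L := (abs_nonneg _).trans (hL ρ hρ)
    rw [Finset.sum_range_succ']
    simp only [Nat.add_eq_zero_iff, one_ne_zero, and_false, if_false, Nat.add_sub_cancel,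
      if_true, pow_zero, mul_one]
    set h : ℝ → ℝ := fun τ => g τ - ∑ i ∈ Finset.range (m + 1), p i / (i + 1 : ℕ) * τ ^ (i + 1)
      with hh
    have hder : ∀ τ, HasDerivAt h (deriv g τ - ∑ i ∈ Finset.range (m + 1), p i * τ ^ i) τ := by
      intro τ
      refine (hd τ).hasDerivAt.sub (HasDerivAt.fun_sum fun i _ => ?_)
      have := (hasDerivAt_pow (i + 1) τ).const_mul (p i / (i + 1 : ℕ))
      have h1 : ((i + 1 : ℕ) : ℝ) ≠ 0 := by positivity
      rwa [← mul_assoc, div_mul_cancel₀ _ h1, Nat.add_sub_cancel] at this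
    have key := (convex_Icc (0 : ℝ) ρ).norm_image_sub_le_of_norm_hasDerivWithin_le
      (f := h) (C := L * ρ ^ m) (fun τ _ => (hder τ).hasDerivWithinAt)
      (fun τ hτ => (hp τ ⟨hτ.1, hτ.2.trans hρ.2⟩).trans (by
        have := hτ.1; have := hτ.2; gcongr))
      (left_mem_Icc.2 hρ.1) (right_mem_Icc.2 hρ.1)
    have h0 : h 0 = g 0 := by simp [hh]
    rw [h0, sub_zero, Real.norm_eq_abs, Real.norm_eq_abs, abs_of_nonneg hρ.1] at key
    calc _ = |h ρ - g 0| := by rw [hh]; congr 1; ring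
      _ ≤ _ := key.trans_eq (by ring)

lemma iteratedDeriv_comp_ray {E : Type*} [NormedAddCommGroup E] [NormedSpace ℝ E] {f : E → ℝ}
    (m : ℕ) (hf : ContDiff ℝ m f) (x y : E) (τ : ℝ) :
    iteratedDeriv m (fun t : ℝ => f (t • x - y)) τ
      = iteratedFDeriv ℝ m f (τ • x - y) (fun _ => x) := by
  have hF : ContDiff ℝ m (fun z => f (z - y)) := hf.comp (contDiff_id.sub contDiff_const)
  have h1 := (ContinuousLinearMap.toSpanSingleton ℝ x).iteratedFDeriv_comp_right hF τ
    (i := m) le_rfl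
  have h2 : (fun z => f (z - y)) ∘ (ContinuousLinearMap.toSpanSingleton ℝ x)
      = fun t : ℝ => f (t • x - y) := by
    ext t; simp
  rw [h2] at h1
  rw [iteratedDeriv_eq_iteratedFDeriv, h1, iteratedFDeriv_comp_sub]
  simp

/-- The `(β - ⌊β⌋)`-Hölder seminorm of the top derivative is controlled by `holderNorm`. -/
lemma norm_iteratedFDeriv_sub_le_holderNorm {d : ℕ} {β : ℝ} {f : Rd d → ℝ}
    (h : holderNorm β f ≠ ∞) (x y : Rd d) :
    ‖iteratedFDeriv ℝ ⌊β⌋₊ f x - iteratedFDeriv ℝ ⌊β⌋₊ f y‖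
      ≤ (holderNorm β f).toReal * ‖x - y‖ ^ (β - ⌊β⌋₊) := by
  by_cases hxy : x = y
  · subst hxy
    simp only [sub_self, norm_zero]
    exact mul_nonneg ENNReal.toReal_nonneg (Real.rpow_nonneg le_rfl _)
  have hpos : 0 < ‖x - y‖ := norm_pos_iff.2 (sub_ne_zero.2 hxy)
  have h1 : ‖iteratedFDeriv ℝ ⌊β⌋₊ f x - iteratedFDeriv ℝ ⌊β⌋₊ f y‖ₑ /
      ‖x - y‖ₑ ^ (β - (⌊β⌋₊ : ℝ)) ≤ holderNorm β f := by
    unfold holderNorm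
    split_ifs
    · refine le_add_left ?_
      exact le_iSup_of_le x (le_iSup_of_le y (le_iSup_of_le hxy le_rfl))
    · exact le_top
  have h2 := ENNReal.toReal_mono h h1
  rw [ENNReal.toReal_div, ← ENNReal.toReal_rpow, toReal_enorm, toReal_enorm,
    div_le_iff₀ (Real.rpow_pos_of_pos hpos _)] at h2
  exact h2

lemma contDiff_of_holderNorm {d : ℕ} {β : ℝ} {f : Rd d → ℝ} (h : holderNorm β f ≠ ∞) :
    ContDiff ℝ (⌊β⌋₊ : ℕ) f := by
  by_contra hc
  exact h (by simp [holderNorm, hc])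

/-- Cancellation of `Δ_k` against a function of class `C^β`, along a ray. -/
lemma abs_sum_ray_le {d k : ℕ} {β : ℝ} (hβ : 0 ≤ β) (hk : d + ⌊β⌋₊ ≤ k) {f : Rd d → ℝ}
    (hf : holderNorm β f ≠ ∞) {r : ℝ} (hr : 0 < r) (x y : Rd d) (hx : ‖x‖ ≤ 1) :
    |∑ j ∈ Finset.range (k + 2), scaleDiffCoeff k j *
        ((r / 2 ^ j) ^ d * f ((r / 2 ^ j) • x - y))|
      ≤ scaleDiffBound k * ((holderNorm β f).toReal * r ^ (d + β)) := by
  set m := ⌊β⌋₊ with hm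
  have hmβ : (m : ℝ) ≤ β := Nat.floor_le hβ
  have hC := contDiff_of_holderNorm hf
  set H := (holderNorm β f).toReal
  have hH : 0 ≤ H := ENNReal.toReal_nonneg
  have hg : ContDiff ℝ m (fun t : ℝ => f (t • x - y)) :=
    hC.comp ((contDiff_id.smul contDiff_const).sub contDiff_const)
  -- Since `‖x‖ ≤ 1`, points of the ray with parameter in `[0, r]` stay within `r` of its origin, so
  -- the top derivative oscillates by at most `H * r ^ (β - m)`.
  obtain ⟨p, hp⟩ := exists_poly_approx m _ hg (H * r ^ (β - m)) r (fun τ hτ => by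
    rw [iteratedDeriv_comp_ray m hC, iteratedDeriv_comp_ray m hC,
      ← _root_.sub_apply, ← Real.norm_eq_abs]
    refine (ContinuousMultilinearMap.le_opNorm _ _).trans ?_
    have h1 : ∏ _i : Fin m, ‖x‖ ≤ 1 := Finset.prod_le_one (fun _ _ => norm_nonneg _)
      (fun _ _ => hx)
    refine (mul_le_of_le_one_right (norm_nonneg _) h1).trans ?_
    refine (norm_iteratedFDeriv_sub_le_holderNorm hf _ _).trans ?_
    have h2 : ‖τ • x - y - ((0 : ℝ) • x - y)‖ ≤ r := by
      rw [zero_smul, zero_sub, sub_neg_eq_add, sub_add_cancel, norm_smul, Real.norm_eq_abs,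
        abs_of_nonneg hτ.1]
      calc τ * ‖x‖ ≤ τ * 1 := by gcongr; exact hτ.1
        _ ≤ r := by simpa using hτ.2
    exact mul_le_mul_of_nonneg_left
      (Real.rpow_le_rpow (norm_nonneg _) h2 (by simpa [hm] using hmβ)) hH)
  -- The Jacobian `ρ ^ d` raises the degrees to `d + i ≤ d + m ≤ k`, still within the range that
  -- `Δ_k` annihilates.
  have hzero : ∑ j ∈ Finset.range (k + 2), scaleDiffCoeff k j *
      ((r / 2 ^ j) ^ d * ∑ i ∈ Finset.range (m + 1), p i * (r / 2 ^ j) ^ i) = 0 := by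
    simp_rw [Finset.mul_sum]
    rw [Finset.sum_comm]
    refine Finset.sum_eq_zero fun i hi => ?_
    have := sum_scaleDiffCoeff_mul_pow k (d + i) (by have := Finset.mem_range.1 hi; omega) r
    rw [← mul_zero (p i), ← this, Finset.mul_sum]
    refine Finset.sum_congr rfl fun j _ => ?_
    rw [pow_add]; ring
  rw [← sub_zero (∑ j ∈ _, _), ← hzero, ← Finset.sum_sub_distrib]
  simp_rw [← mul_sub]
  refine abs_sum_scaleDiffCoeff_le k _ _ fun j => ?_
  have hj0 : 0 < r / 2 ^ j := by positivity
  have hj1 : r / 2 ^ j ≤ r := div_le_self hr.le (one_le_pow₀ one_le_two)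
  rw [abs_mul, abs_of_nonneg (by positivity)]
  calc (r / 2 ^ j) ^ d * _ ≤ r ^ d * (H * r ^ (β - m) * r ^ m) := by
        gcongr
        refine (hp _ ⟨hj0.le, hj1⟩).trans ?_
        gcongr
    _ = H * r ^ (d + β) := by
        rw [Real.rpow_add hr, Real.rpow_natCast, Real.rpow_sub hr, Real.rpow_natCast]
        have : r ^ m ≠ 0 := by positivity
        field_simp

/-- Cancellation of `Δ_k` against a function of class `C^β`, over balls. -/
lemma abs_sum_ball_le {d k : ℕ} {β : ℝ} (hβ : 0 ≤ β) (hk : d + ⌊β⌋₊ ≤ k) {f : Rd d → ℝ}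
    (hf : holderNorm β f ≠ ∞) {r : ℝ} (hr : 0 < r) (y : Rd d) :
    |∑ j ∈ Finset.range (k + 2), scaleDiffCoeff k j *
        ∫ x in Metric.closedBall (0 : Rd d) (r / 2 ^ j), f (x - y)|
      ≤ scaleDiffBound k * ((holderNorm β f).toReal * r ^ (d + β))
          * volume.real (Metric.closedBall (0 : Rd d) 1) := by
  have hcont : Continuous f := (contDiff_of_holderNorm hf).continuous
  have hint : ∀ ρ : ℝ,
      IntegrableOn (fun x => f (ρ • x - y)) (Metric.closedBall (0 : Rd d) 1) volume := fun ρ =>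
    ContinuousOn.integrableOn_compact (isCompact_closedBall _ _)
      (by fun_prop : Continuous fun x => f (ρ • x - y)).continuousOn
  -- Scaling all balls to the unit ball brings the sum over `j` inside one integral, where the
  -- estimate along rays applies pointwise.
  have hscale : ∀ j : ℕ, ∫ x in Metric.closedBall (0 : Rd d) (r / 2 ^ j), f (x - y)
      = ∫ x in Metric.closedBall (0 : Rd d) 1, (r / 2 ^ j) ^ d * f ((r / 2 ^ j) • x - y) := by
    intro j
    have hj0 : 0 < r / 2 ^ j := by positivity
    rw [integral_const_mul,
      Measure.setIntegral_comp_smul_of_pos volume (fun x => f (x - y)) _ hj0,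
      smul_unitClosedBall_of_nonneg hj0.le]
    simp only [finrank_euclideanSpace, Fintype.card_fin, smul_eq_mul]
    rw [← mul_assoc, mul_inv_cancel₀ (by positivity), one_mul]
  simp_rw [hscale, ← integral_const_mul]
  rw [← integral_finsetSum _ fun j _ => ((hint (r / 2 ^ j)).const_mul _).const_mul _]
  rw [← Real.norm_eq_abs]
  refine norm_setIntegral_le_of_norm_le_const measure_closedBall_lt_top fun x hx => ?_
  exact abs_sum_ray_le hβ hk hf hr x y (by simpa using hx)

/-! ### The kernel of `Δ_k` -/

/-- The function `z ↦ (Δ_k)_r 1_{|z| ≤ r}`. -/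
noncomputable def ballKernel {d : ℕ} (k : ℕ) (r : ℝ) (z : Rd d) : ℝ :=
  scaleDiff k (fun ρ => (Metric.closedBall (0 : Rd d) ρ).indicator (fun _ => 1) z) r

lemma ballKernel_eq_sum {d : ℕ} (k : ℕ) (r : ℝ) (z : Rd d) :
    ballKernel k r z = ∑ j ∈ Finset.range (k + 2), scaleDiffCoeff k j *
      (Metric.closedBall (0 : Rd d) (r / 2 ^ j)).indicator (fun _ => 1) z :=
  scaleDiff_eq_sum _ _ _

@[fun_prop]
lemma measurable_ballKernel {d : ℕ} (k : ℕ) (r : ℝ) :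
    Measurable (ballKernel k r : Rd d → ℝ) := by
  simp only [funext (ballKernel_eq_sum k r)]
  refine Finset.measurable_fun_sum _ fun j _ => Measurable.const_mul ?_ _
  exact measurable_const.indicator measurableSet_closedBall

lemma abs_ballKernel_le {d : ℕ} (k : ℕ) (r : ℝ) (z : Rd d) :
    |ballKernel k r z| ≤ scaleDiffBound k := by
  refine (abs_scaleDiff_le k _ r 1 fun j => ?_).trans_eq (mul_one _)
  by_cases h : z ∈ Metric.closedBall (0 : Rd d) (r / 2 ^ j) <;> simp [indicator, h]

lemma abs_ballKernel_le_indicator {d : ℕ} (k : ℕ) {r : ℝ} (hr : 0 < r) (z : Rd d) :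
    |ballKernel k r z| ≤
      (Metric.closedBall (0 : Rd d) r).indicator (fun _ => scaleDiffBound k) z := by
  by_cases hz : z ∈ Metric.closedBall (0 : Rd d) r
  · rw [indicator_of_mem hz]
    exact abs_ballKernel_le k r z
  · rw [indicator_of_notMem hz]
    refine (abs_scaleDiff_le k _ r 0 fun j => ?_).trans_eq (mul_zero _)
    have : z ∉ Metric.closedBall (0 : Rd d) (r / 2 ^ j) := fun h => hz
      (Metric.closedBall_subset_closedBall (div_le_self hr.le (one_le_pow₀ one_le_two)) h)
    simp [indicator_of_notMem this]

lemma integrable_ballKernel {d : ℕ} (k : ℕ) {r : ℝ} (hr : 0 < r) :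
    Integrable (ballKernel k r : Rd d → ℝ) := by
  refine Integrable.mono' (g := (Metric.closedBall (0 : Rd d) r).indicator
    (fun _ => scaleDiffBound k)) ?_ (measurable_ballKernel k r).aestronglyMeasurable
    (.of_forall fun z => abs_ballKernel_le_indicator k hr z)
  exact (integrable_indicator_iff measurableSet_closedBall).2
    (integrableOn_const measure_closedBall_lt_top.ne)

/-- The volume of the unit ball. -/
noncomputable def unitBallVol (d : ℕ) : ℝ := volume.real (Metric.closedBall (0 : Rd d) 1)

lemma unitBallVol_pos (d : ℕ) : 0 < unitBallVol d :=
  ENNReal.toReal_pos (Metric.measure_closedBall_pos _ _ one_pos).ne' measure_closedBall_lt_top.ne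

lemma unitBallVol_nonneg (d : ℕ) : 0 ≤ unitBallVol d := measureReal_nonneg

lemma volume_closedBall_eq {d : ℕ} {r : ℝ} (hr : 0 < r) :
    volume.real (Metric.closedBall (0 : Rd d) r) = r ^ d * unitBallVol d := by
  rw [unitBallVol, measureReal_def, Measure.addHaar_closedBall' volume _ hr.le, ENNReal.toReal_mul,
    ENNReal.toReal_ofReal (by positivity), measureReal_def]
  simp

lemma integral_abs_ballKernel_le {d : ℕ} (k : ℕ) {r : ℝ} (hr : 0 < r) :
    ∫ z : Rd d, |ballKernel k r z| ≤ scaleDiffBound k * (r ^ d * unitBallVol d) := by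
  calc ∫ z : Rd d, |ballKernel k r z|
      ≤ ∫ z, (Metric.closedBall (0 : Rd d) r).indicator (fun _ => scaleDiffBound k) z := by
        refine integral_mono (integrable_ballKernel k hr).abs
          ((integrable_indicator_iff measurableSet_closedBall).2
            (integrableOn_const measure_closedBall_lt_top.ne))
          fun z => abs_ballKernel_le_indicator k hr z
    _ = _ := by
        rw [integral_indicator measurableSet_closedBall, setIntegral_const,
          volume_closedBall_eq hr, smul_eq_mul, mul_comm]

lemma lintegral_enorm_ballKernel_le {d : ℕ} (k : ℕ) {r : ℝ} (hr : 0 < r) :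
    ∫⁻ z : Rd d, ‖ballKernel k r z‖ₑ
      ≤ ENNReal.ofReal (scaleDiffBound k * (r ^ d * unitBallVol d)) := by
  rw [← ofReal_integral_norm_eq_lintegral_enorm (integrable_ballKernel k hr)]
  exact ENNReal.ofReal_le_ofReal (integral_abs_ballKernel_le k hr)

/-- The autocorrelation of the kernel of `Δ_k`. -/
noncomputable def ballCorr {d : ℕ} (k : ℕ) (r : ℝ) (z : Rd d) : ℝ :=
  ∫ y : Rd d, ballKernel k r y * ballKernel k r (z + y)

lemma measurable_ballCorr {d : ℕ} (k : ℕ) (r : ℝ) : Measurable (ballCorr k r : Rd d → ℝ) := by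
  refine (StronglyMeasurable.integral_prod_right (ν := volume)
    (f := fun (z : Rd d) (y : Rd d) => ballKernel k r y * ballKernel k r (z + y)) ?_).measurable
  exact Measurable.stronglyMeasurable (by fun_prop)

lemma abs_ballCorr_le {d : ℕ} (k : ℕ) {r : ℝ} (hr : 0 < r) (z : Rd d) :
    |ballCorr k r z| ≤ scaleDiffBound k * (scaleDiffBound k * (r ^ d * unitBallVol d)) := by
  have hC := scaleDiffBound_nonneg k
  rw [← Real.norm_eq_abs]
  refine (norm_integral_le_of_norm_le
    (g := fun y : Rd d => scaleDiffBound k * |ballKernel k r y|)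
    ((integrable_ballKernel k hr).abs.const_mul _) (.of_forall fun y => ?_)).trans ?_
  · rw [norm_mul, mul_comm]
    exact mul_le_mul_of_nonneg_right (abs_ballKernel_le k r _) (norm_nonneg _)
  · rw [integral_const_mul]
    exact mul_le_mul_of_nonneg_left (integral_abs_ballKernel_le k hr) hC

/-- The kernel of `Δ_k` integrates functions of class `C^β` to order `r^(d+β)`. -/
lemma abs_integral_ballKernel_mul_le {d k : ℕ} {β : ℝ} (hβ : 0 ≤ β) (hk : d + ⌊β⌋₊ ≤ k)
    {f : Rd d → ℝ} (hf : holderNorm β f ≠ ∞) {r : ℝ} (hr : 0 < r) (y : Rd d) :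
    |∫ z, f z * ballKernel k r (z + y)|
      ≤ scaleDiffBound k * ((holderNorm β f).toReal * r ^ (d + β)) * unitBallVol d := by
  have h1 : ∫ z, f z * ballKernel k r (z + y) = ∫ x, f (x - y) * ballKernel k r x := by
    rw [← integral_add_right_eq_self (fun x => f (x - y) * ballKernel k r x) y]
    simp
  have hcont : Continuous f := (contDiff_of_holderNorm hf).continuous
  have h2 : ∀ x, f (x - y) * ballKernel k r x = ∑ j ∈ Finset.range (k + 2),
      scaleDiffCoeff k j *
        (Metric.closedBall (0 : Rd d) (r / 2 ^ j)).indicator (fun x => f (x - y)) x := by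
    intro x
    rw [ballKernel_eq_sum, Finset.mul_sum]
    refine Finset.sum_congr rfl fun j _ => ?_
    by_cases h : x ∈ Metric.closedBall (0 : Rd d) (r / 2 ^ j)
    · rw [indicator_of_mem h, indicator_of_mem h]; ring
    · rw [indicator_of_notMem h, indicator_of_notMem h]; ring
  have hint : ∀ j : ℕ, Integrable
      ((Metric.closedBall (0 : Rd d) (r / 2 ^ j)).indicator fun x => f (x - y)) volume := fun j =>
    (integrable_indicator_iff measurableSet_closedBall).2
      (ContinuousOn.integrableOn_compact (isCompact_closedBall _ _)
        (by fun_prop : Continuous fun x => f (x - y)).continuousOn)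
  rw [h1]
  simp_rw [h2]
  rw [integral_finsetSum _ fun j _ => (hint j).const_mul _]
  simp_rw [integral_const_mul, integral_indicator measurableSet_closedBall]
  exact abs_sum_ball_le hβ hk hf hr y

/-- Fubini lets one copy of the kernel act on `f`, gaining `r ^ (d + β)` by cancellation; the other
is estimated by its `L¹` norm, of order `r ^ d`. -/
lemma abs_integral_ballCorr_density_le {d k : ℕ} {β : ℝ} (hβ : 0 ≤ β) (hk : d + ⌊β⌋₊ ≤ k)
    {f : Rd d → ℝ} (hf : holderNorm β f ≠ ∞) (hfi : Integrable f) {r : ℝ} (hr : 0 < r) :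
    |∫ z, f z * ballCorr k r z|
      ≤ scaleDiffBound k * (r ^ d * unitBallVol d) *
        (scaleDiffBound k * ((holderNorm β f).toReal * r ^ (d + β)) * unitBallVol d) := by
  set M := scaleDiffBound k * ((holderNorm β f).toReal * r ^ (d + β)) * unitBallVol d
  have hM : 0 ≤ M := (abs_nonneg _).trans (abs_integral_ballKernel_mul_le hβ hk hf hr 0)
  have h1 : ∫ z, f z * ballCorr k r z
      = ∫ y, ballKernel k r y * ∫ z, f z * ballKernel k r (z + y) := by
    simp_rw [ballCorr, ← integral_const_mul]
    rw [integral_integral_swap]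
    · refine integral_congr_ae (.of_forall fun y => integral_congr_ae (.of_forall fun z => ?_))
      ring_nf
    · have h := (hfi.mul_prod (integrable_ballKernel k hr)).mul_bdd
        (g := fun p : Rd d × Rd d => ballKernel k r (p.1 + p.2)) (c := scaleDiffBound k)
        (Measurable.aestronglyMeasurable (by fun_prop))
        (.of_forall fun p => abs_ballKernel_le k r _)
      refine h.congr (.of_forall fun p => ?_)
      simp [Function.uncurry, mul_assoc]
  rw [h1]
  rw [← Real.norm_eq_abs]
  refine (norm_integral_le_of_norm_le (g := fun y : Rd d => |ballKernel k r y| * M)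
    ((integrable_ballKernel k hr).abs.mul_const _) (.of_forall fun y => ?_)).trans ?_
  · rw [norm_mul]
    exact mul_le_mul_of_nonneg_left (abs_integral_ballKernel_mul_le hβ hk hf hr y) (norm_nonneg _)
  · rw [integral_mul_const]
    exact mul_le_mul_of_nonneg_right (integral_abs_ballKernel_le k hr) hM

/-- The expectation of the autocorrelation kernel under a law of class `C^β`. -/
lemma enorm_integral_ballCorr_le {d k : ℕ} {β : ℝ} (hβ : 0 ≤ β) (hk : d + ⌊β⌋₊ ≤ k)
    (ν : Measure (Rd d)) [IsFiniteMeasure ν] {r : ℝ} (hr : 0 < r) :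
    ‖∫ z, ballCorr k r z ∂ν‖ₑ
      ≤ ENNReal.ofReal ((scaleDiffBound k * unitBallVol d) ^ 2 * r ^ (2 * d + β)) *
        measureHolderNorm β ν := by
  set A := (scaleDiffBound k * unitBallVol d) ^ 2 * r ^ (2 * d + β) with hA
  have hA0 : 0 < A := by
    have := scaleDiffBound_pos k
    have := unitBallVol_pos d
    positivity
  have hA1 : ENNReal.ofReal A ≠ 0 := by simpa using hA0
  simp_rw [measureHolderNorm, ENNReal.mul_iInf_of_ne hA1 ENNReal.ofReal_ne_top]
  refine le_iInf₂ fun f ⟨hf0, hfm, hν⟩ => ?_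
  by_cases hf : holderNorm β f = ∞
  · rw [hf, ENNReal.mul_top hA1]
    exact le_top
  have hfi : Integrable f := by
    refine ⟨hfm.aestronglyMeasurable, ?_⟩
    rw [hasFiniteIntegral_iff_ofReal (.of_forall hf0), ← setLIntegral_univ,
      ← withDensity_apply _ MeasurableSet.univ, ← hν]
    exact measure_lt_top ν univ
  rw [← ENNReal.ofReal_toReal hf, ← ENNReal.ofReal_mul hA0.le, ← ofReal_norm]
  refine ENNReal.ofReal_le_ofReal ?_
  rw [hν, integral_withDensity_eq_integral_toReal_smul (by fun_prop)
    (.of_forall fun _ => ENNReal.ofReal_lt_top)]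
  simp_rw [ENNReal.toReal_ofReal (hf0 _), smul_eq_mul]
  refine (abs_integral_ballCorr_density_le hβ hk hf hfi hr).trans_eq ?_
  rw [hA, show (2 * d + β : ℝ) = d + (d + β) by ring, Real.rpow_add hr (d : ℝ) (d + β),
    Real.rpow_natCast]
  ring

/-! ### Comparison of `Δ_k` and `Δ_(k+1)` -/

instance : SFinite drOverR := by unfold drOverR; infer_instance

lemma lintegral_drOverR {f : ℝ → ℝ≥0∞} (hf : Measurable f) :
    ∫⁻ r, f r ∂drOverR = ∫⁻ r in Ioi 0, ENNReal.ofReal r⁻¹ * f r := by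
  rw [drOverR, lintegral_withDensity_eq_lintegral_mul _ (by fun_prop) hf]
  rfl

lemma ae_drOverR_pos : ∀ᵐ r ∂drOverR, 0 < r :=
  (withDensity_absolutelyContinuous _ _).ae_le (ae_restrict_mem measurableSet_Ioi)

lemma measurePreserving_two_mul : MeasurePreserving (fun r : ℝ => 2 * r) drOverR drOverR := by
  have hm : Measurable fun r : ℝ => 2 * r := measurable_const_mul 2
  refine ⟨hm, Measure.ext fun s hs => ?_⟩
  rw [Measure.map_apply hm hs, ← lintegral_indicator_one hs, ← lintegral_indicator_one (hm hs),
    lintegral_drOverR (measurable_one.indicator hs),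
    lintegral_drOverR (measurable_one.indicator (hm hs)),
    ← lintegral_indicator measurableSet_Ioi, ← lintegral_indicator measurableSet_Ioi]
  set G : ℝ → ℝ≥0∞ := (Ioi 0).indicator fun r => ENNReal.ofReal r⁻¹ * s.indicator 1 r
  have hG : Measurable G :=
    Measurable.indicator ((by fun_prop : Measurable fun r : ℝ => ENNReal.ofReal r⁻¹).mul
      (measurable_one.indicator hs)) measurableSet_Ioi
  have h1 : ∫⁻ r, G (2 * r) = ENNReal.ofReal |(2 : ℝ)⁻¹| * ∫⁻ r, G r := by
    rw [← lintegral_map hG hm, Real.map_volume_mul_left two_ne_zero, lintegral_smul_measure,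
      smul_eq_mul]
  have h2 : ∀ r, (Ioi 0).indicator (fun r => ENNReal.ofReal r⁻¹ *
      ((fun r : ℝ => 2 * r) ⁻¹' s).indicator 1 r) r = 2 * G (2 * r) := by
    intro r
    by_cases hr : 0 < r
    · have hr2 : 0 < 2 * r := by positivity
      simp only [G, indicator_of_mem (show r ∈ Ioi 0 from hr),
        indicator_of_mem (show 2 * r ∈ Ioi 0 from hr2)]
      rw [← mul_assoc]
      congr 1
      rw [← ENNReal.ofReal_ofNat 2, ← ENNReal.ofReal_mul (by positivity)]
      congr 1
      field_simp
    · have hr2 : ¬ 0 < 2 * r := by linarith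
      simp [G, hr]
  simp_rw [h2]
  have hG2 : Measurable fun r => G (2 * r) := hG.comp hm
  rw [lintegral_const_mul _ hG2, h1, ← mul_assoc, ← ENNReal.ofReal_ofNat 2,
    ← ENNReal.ofReal_mul (by positivity)]
  norm_num

@[fun_prop]
lemma measurable_scaleDiff {X : Type*} [MeasurableSpace X] {F : X → ℝ → ℝ} (k : ℕ)
    (hF : Measurable (Function.uncurry F)) {g : X → ℝ} (hg : Measurable g) :
    Measurable fun x => scaleDiff k (F x) (g x) := by
  simp_rw [scaleDiff_eq_sum]
  refine Finset.measurable_fun_sum _ fun j _ => Measurable.const_mul ?_ _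
  exact hF.comp (measurable_id.prodMk (hg.div_const _))

/-- The weight is square integrable for `dr / r` away from zero. This a priori finiteness is what
makes the absorption in `eLpNorm_scaleDiff_le_succ` legitimate. -/
lemma eLpNorm_truncated_lt_top {γ : ℝ} (hγ : 0 < γ) {ε : ℝ} (hε : 0 < ε) {g : ℝ → ℝ}
    (hg : Measurable g) {M : ℝ} (hM : ∀ r, |g r| ≤ M) :
    eLpNorm ((Ioi ε).indicator fun r => r ^ (-γ) * g r) 2 drOverR < ∞ := by
  have hmeas : Measurable ((Ioi ε).indicator fun r => r ^ (-γ) * g r) :=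
    Measurable.indicator (by fun_prop) measurableSet_Ioi
  rw [eLpNorm_lt_top_iff_lintegral_rpow_enorm_lt_top two_ne_zero ENNReal.ofNat_ne_top,
    lintegral_drOverR (by fun_prop)]
  have hint : IntegrableOn (fun r : ℝ => M ^ 2 * r ^ (-1 - 2 * γ)) (Ioi ε) :=
    (integrableOn_Ioi_rpow_of_lt (by linarith) hε).const_mul _
  calc ∫⁻ r in Ioi 0, ENNReal.ofReal r⁻¹ *
        ‖(Ioi ε).indicator (fun r => r ^ (-γ) * g r) r‖ₑ ^ (2 : ℝ≥0∞).toReal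
      ≤ ∫⁻ r in Ioi 0, (Ioi ε).indicator
          (fun r => ENNReal.ofReal (M ^ 2 * r ^ (-1 - 2 * γ))) r := by
        refine setLIntegral_mono
          (Measurable.indicator (by fun_prop) measurableSet_Ioi) fun r hr => ?_
        by_cases hrε : r ∈ Ioi ε
        · rw [indicator_of_mem hrε, indicator_of_mem hrε]
          have hr : 0 < r := hr
          rw [← ofReal_norm, ENNReal.toReal_ofNat, ENNReal.rpow_ofNat,
            ← ENNReal.ofReal_pow (norm_nonneg _), ← ENNReal.ofReal_mul (by positivity)]
          refine ENNReal.ofReal_le_ofReal ?_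
          rw [norm_mul, Real.norm_of_nonneg (Real.rpow_nonneg hr.le _), Real.norm_eq_abs,
            show (-1 - 2 * γ) = -1 + (-γ + -γ) by ring, Real.rpow_add hr, Real.rpow_add hr,
            Real.rpow_neg_one]
          have := pow_le_pow_left₀ (abs_nonneg (g r)) (hM r) 2
          calc _ = |g r| ^ 2 * (r⁻¹ * (r ^ (-γ) * r ^ (-γ))) := by ring
            _ ≤ _ := by gcongr
        · rw [indicator_of_notMem hrε, indicator_of_notMem hrε]
          simp
    _ = ∫⁻ r in Ioi ε, ENNReal.ofReal (M ^ 2 * r ^ (-1 - 2 * γ)) := by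
        rw [setLIntegral_indicator measurableSet_Ioi]
        congr 2
        exact inter_eq_left.2 (Ioi_subset_Ioi hε.le)
    _ < ∞ := hint.lintegral_lt_top

/-- The weighted `L²(dr/r)` norm of `Δ_k F` is controlled by that of `Δ_(k+1) F`. -/
lemma eLpNorm_scaleDiff_le_succ {γ : ℝ} (hγ : 0 < γ) {k : ℕ} (hk : γ < k + 1) {F : ℝ → ℝ}
    (hF : Measurable F) {M : ℝ} (hM : ∀ r, |F r| ≤ M) :
    eLpNorm (fun r => r ^ (-γ) * scaleDiff k F r) 2 drOverR
      ≤ ENNReal.ofReal (2 ^ (γ - k - 1) / (1 - 2 ^ (γ - k - 1))) *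
        eLpNorm (fun r => r ^ (-γ) * scaleDiff (k + 1) F r) 2 drOverR := by
  set θ : ℝ := 2 ^ (γ - k - 1) with hθ
  have hθ0 : 0 < θ := by positivity
  have hθ1 : θ < 1 := Real.rpow_lt_one_of_one_lt_of_neg one_lt_two (by linarith)
  have hmk : ∀ k, Measurable fun r => scaleDiff k F r := fun k =>
    measurable_scaleDiff (F := fun _ => F) k (hF.comp measurable_snd) measurable_id
  set f : ℝ → ℝ := fun r => r ^ (-γ) * scaleDiff k F r with hf
  set f' : ℝ → ℝ := fun r => r ^ (-γ) * scaleDiff (k + 1) F r with hf'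
  have hfm : Measurable f := by have := hmk k; fun_prop
  have hfm' : Measurable f' := by have := hmk (k + 1); fun_prop
  -- The recursion defining `Δ_(k+1)`, read at `2 * r` and solved for `Δ_k F(r)`; the weight turns
  -- `2 ^ (-(k + 1))` into `θ`.
  have hrec : ∀ r : ℝ, 0 < r → f r = θ * (f (2 * r) - f' (2 * r)) := by
    intro r hr
    simp only [hf, hf', scaleDiff, mul_div_cancel_left₀ r (two_ne_zero' ℝ)]
    rw [Real.mul_rpow zero_le_two hr.le, hθ]
    have h2 : (2 : ℝ) ^ (γ - k - 1) * 2 ^ (-γ) * 2 ^ (k + 1) = 1 := by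
      rw [← Real.rpow_natCast 2 (k + 1), ← Real.rpow_add two_pos, ← Real.rpow_add two_pos,
        show γ - k - 1 + -γ + ((k + 1 : ℕ) : ℝ) = 0 by push_cast; ring, Real.rpow_zero]
    linear_combination (-(r ^ (-γ) * scaleDiff k F r)) * h2
  -- Doubling maps `(ε, ∞)` into itself and preserves `dr / r`, so the truncated norm is at most `θ`
  -- times itself plus `θ` times the norm of `f'`. Being finite, it can be absorbed, with a bound
  -- uniform in `ε`.
  have htrunc : ∀ ε : ℝ, 0 < ε → eLpNorm ((Ioi ε).indicator f) 2 drOverR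
      ≤ ENNReal.ofReal (θ / (1 - θ)) * eLpNorm f' 2 drOverR := by
    intro ε hε
    set f₁ := (Ioi ε).indicator f
    set f₂ := (Ioi ε).indicator f'
    have hm₁ : Measurable f₁ := hfm.indicator measurableSet_Ioi
    have hm₂ : Measurable f₂ := hfm'.indicator measurableSet_Ioi
    have hfin : eLpNorm f₁ 2 drOverR < ∞ :=
      eLpNorm_truncated_lt_top hγ hε (hmk k) fun r => abs_scaleDiff_le k F r M fun _ => hM _
    have hle : eLpNorm f₁ 2 drOverR
        ≤ ENNReal.ofReal θ * (eLpNorm f₁ 2 drOverR + eLpNorm f' 2 drOverR) := by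
      calc eLpNorm f₁ 2 drOverR
          ≤ eLpNorm (fun r => θ * ((f₁ - f₂) ∘ fun r => 2 * r) r) 2 drOverR := by
            refine eLpNorm_mono fun r => ?_
            by_cases hr : r ∈ Ioi ε
            · have hr0 : 0 < r := hε.trans hr
              have hr2 : 2 * r ∈ Ioi ε := by have : ε < r := hr; simp; linarith
              simp only [f₁, f₂, Function.comp, Pi.sub_apply]
              rw [indicator_of_mem hr, indicator_of_mem hr2, indicator_of_mem hr2, hrec r hr0]
            · simp only [f₁, indicator_of_notMem hr, norm_zero, norm_nonneg]
        _ = ENNReal.ofReal θ * eLpNorm (f₁ - f₂) 2 drOverR := by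
            rw [← eLpNorm_comp_measurePreserving (hm₁.sub hm₂).aestronglyMeasurable
              measurePreserving_two_mul]
            have := eLpNorm_const_smul θ ((f₁ - f₂) ∘ fun r => 2 * r) 2 drOverR
            rw [Real.enorm_of_nonneg hθ0.le] at this
            exact this
        _ ≤ _ := by
            gcongr
            refine (eLpNorm_sub_le hm₁.aestronglyMeasurable hm₂.aestronglyMeasurable
              one_le_two).trans ?_
            gcongr
            exact eLpNorm_indicator_le _
    by_cases hinf : eLpNorm f' 2 drOverR = ∞
    · rw [hinf, ENNReal.mul_top]
      · exact le_top
      · have : 0 < θ / (1 - θ) := div_pos hθ0 (by linarith)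
        simpa using this
    rw [← ENNReal.ofReal_toReal hinf, ← ENNReal.ofReal_toReal hfin.ne] at hle ⊢
    rw [← ENNReal.ofReal_add (by simp) (by simp), ← ENNReal.ofReal_mul hθ0.le,
      ENNReal.ofReal_le_ofReal_iff (by positivity)] at hle
    rw [← ENNReal.ofReal_mul (div_nonneg hθ0.le (by linarith))]
    refine ENNReal.ofReal_le_ofReal ?_
    rw [div_mul_eq_mul_div, le_div_iff₀ (by linarith)]
    linarith
  have hlim : ∀ᵐ r ∂drOverR, Filter.Tendsto
      (fun n : ℕ => (Ioi (1 / ((n : ℝ) + 1))).indicator f r) Filter.atTop (nhds (f r)) := by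
    filter_upwards [ae_drOverR_pos] with r hr
    refine tendsto_const_nhds.congr' ?_
    filter_upwards [(tendsto_one_div_add_atTop_nhds_zero_nat (𝕜 := ℝ)).eventually_lt_const hr]
      with n hn
    exact (indicator_of_mem (show r ∈ Ioi _ from hn) _).symm
  refine (Lp.eLpNorm_lim_le_liminf_eLpNorm
    (fun n => (hfm.indicator measurableSet_Ioi).aestronglyMeasurable) f hlim).trans ?_
  refine Filter.liminf_le_of_le (by isBoundedDefault) fun b hb => ?_
  obtain ⟨n, hn⟩ := hb.exists
  exact hn.trans (htrunc _ (by positivity))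

lemma exists_eLpNorm_scaleDiff_le_add {γ : ℝ} (hγ : 0 < γ) {k : ℕ} (hk : γ < k + 1) (n : ℕ) :
    ∃ C : ℝ≥0∞, C ≠ ∞ ∧ ∀ F : ℝ → ℝ, Measurable F → (∃ M, ∀ r, |F r| ≤ M) →
      eLpNorm (fun r => r ^ (-γ) * scaleDiff k F r) 2 drOverR
        ≤ C * eLpNorm (fun r => r ^ (-γ) * scaleDiff (k + n) F r) 2 drOverR := by
  induction n with
  | zero => exact ⟨1, ENNReal.one_ne_top, fun F _ _ => by simp⟩
  | succ n ih =>
    obtain ⟨C, hC, h⟩ := ih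
    refine ⟨C * ENNReal.ofReal (2 ^ (γ - (k + n : ℕ) - 1) / (1 - 2 ^ (γ - (k + n : ℕ) - 1))),
      ENNReal.mul_ne_top hC ENNReal.ofReal_ne_top, fun F hF hM => ?_⟩
    refine (h F hF hM).trans ?_
    obtain ⟨M, hM⟩ := hM
    rw [mul_assoc]
    gcongr
    exact eLpNorm_scaleDiff_le_succ hγ (by push_cast; linarith) hF hM

/-! ### Occupation measures of measurable paths -/

lemma measurable_ballKernel_comp {X : Type*} [MeasurableSpace X] {d : ℕ} (k : ℕ) {r : X → ℝ}
    (hr : Measurable r) {z : X → Rd d} (hz : Measurable z) :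
    Measurable fun x => ballKernel k (r x) (z x) := by
  unfold ballKernel
  refine measurable_scaleDiff (F := fun x ρ =>
    (Metric.closedBall (0 : Rd d) ρ).indicator (fun _ => (1 : ℝ)) (z x)) k ?_ hr
  have hset : MeasurableSet {p : X × ℝ | ‖z p.1‖ ≤ p.2} :=
    measurableSet_le (by fun_prop) measurable_snd
  convert (measurable_const (a := (1 : ℝ))).indicator hset using 1
  ext p
  simp [Function.uncurry, indicator]

lemma ballMass_occupation {d : ℕ} {w : ℝ → Rd d} (hw : Measurable w) (s t ρ : ℝ) (y : Rd d) :
    ballMass (occupation w s t) ρ y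
      = ∫ u in Ioc s t, (Metric.closedBall (0 : Rd d) ρ).indicator (fun _ => 1) (w u - y) := by
  have hm : MeasurableSet (w ⁻¹' Metric.closedBall y ρ) := hw measurableSet_closedBall
  rw [ballMass, occupation, Measure.toSignedMeasure_apply_measurable measurableSet_closedBall,
    map_measureReal_apply hw measurableSet_closedBall, ← integral_indicator_one hm]
  refine integral_congr_ae (.of_forall fun u => ?_)
  simp [indicator, dist_eq_norm]

/-- The value of `(Δ_k)_r F_μ(r, y)` for the occupation measure `μ` of `w` on `(s, t]`. -/
noncomputable def occDiff {d : ℕ} (k : ℕ) (w : ℝ → Rd d) (s t r : ℝ) (y : Rd d) : ℝ :=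
  ∫ u in Ioc s t, ballKernel k r (w u - y)

lemma integrable_ballKernel_path {d : ℕ} {μ : Measure ℝ} [IsFiniteMeasure μ] {w : ℝ → Rd d}
    (hw : Measurable w) (k : ℕ) (r : ℝ) (y : Rd d) :
    Integrable (fun u => ballKernel k r (w u - y)) μ :=
  Integrable.of_bound (Measurable.aestronglyMeasurable (by fun_prop)) (scaleDiffBound k)
    (.of_forall fun _ => abs_ballKernel_le k r _)

lemma scaleDiff_ballMass_occupation {d : ℕ} {w : ℝ → Rd d} (hw : Measurable w) (k : ℕ)
    (s t r : ℝ) (y : Rd d) :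
    scaleDiff k (fun ρ => ballMass (occupation w s t) ρ y) r = occDiff k w s t r y := by
  simp_rw [scaleDiff_eq_sum, occDiff, ballKernel_eq_sum, ballMass_occupation hw,
    ← integral_const_mul]
  rw [integral_finsetSum]
  intro j _
  refine Integrable.const_mul ?_ _
  refine Integrable.of_bound (Measurable.aestronglyMeasurable ?_) 1 (.of_forall fun u => ?_)
  · exact (measurable_const.indicator measurableSet_closedBall).comp (hw.sub_const y)
  · by_cases h : w u - y ∈ Metric.closedBall (0 : Rd d) (r / 2 ^ j) <;> simp [indicator, h]

lemma abs_ballMass_occupation_le {d : ℕ} {w : ℝ → Rd d} (hw : Measurable w) (s t ρ : ℝ)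
    (y : Rd d) : |ballMass (occupation w s t) ρ y| ≤ volume.real (Ioc s t) := by
  rw [ballMass_occupation hw, ← Real.norm_eq_abs, ← one_mul (volume.real _)]
  refine norm_setIntegral_le_of_norm_le_const measure_Ioc_lt_top fun u _ => ?_
  by_cases h : w u - y ∈ Metric.closedBall (0 : Rd d) ρ <;> simp [indicator, h]

lemma measurable_ballMass_occupation {d : ℕ} {w : ℝ → Rd d} (hw : Measurable w) (s t : ℝ)
    (y : Rd d) : Measurable fun ρ => ballMass (occupation w s t) ρ y := by
  simp_rw [ballMass_occupation hw]
  refine (StronglyMeasurable.integral_prod_right (ν := volume.restrict (Ioc s t))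
    (f := fun (ρ : ℝ) (u : ℝ) =>
      (Metric.closedBall (0 : Rd d) ρ).indicator (fun _ => (1 : ℝ)) (w u - y)) ?_).measurable
  refine Measurable.stronglyMeasurable ?_
  have hset : MeasurableSet {p : ℝ × ℝ | ‖w p.2 - y‖ ≤ p.1} :=
    measurableSet_le (by fun_prop) measurable_fst
  convert (measurable_const (a := (1 : ℝ))).indicator hset using 1
  ext p
  simp [Function.uncurry, indicator]

lemma measurable_occDiff {X : Type*} [MeasurableSpace X] {d : ℕ} (k : ℕ) {W : ℝ → X → Rd d}
    (hW : Measurable (Function.uncurry W)) (s t : ℝ) {r : X → ℝ} (hr : Measurable r)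
    {y : X → Rd d} (hy : Measurable y) :
    Measurable fun x => occDiff k (fun u => W u x) s t (r x) (y x) := by
  refine (StronglyMeasurable.integral_prod_right (ν := volume.restrict (Ioc s t))
    (f := fun (x : X) (u : ℝ) => ballKernel k (r x) (W u x - y x)) ?_).measurable
  refine Measurable.stronglyMeasurable ?_
  exact measurable_ballKernel_comp k (hr.comp measurable_fst)
    ((hW.comp (measurable_snd.prodMk measurable_fst)).sub (hy.comp measurable_fst))

lemma occDiff_add {d : ℕ} {w : ℝ → Rd d} (hw : Measurable w) (k : ℕ) {s t u : ℝ} (hst : s ≤ t)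
    (htu : t ≤ u) (r : ℝ) (y : Rd d) :
    occDiff k w s u r y = occDiff k w s t r y + occDiff k w t u r y := by
  rw [occDiff, ← Ioc_union_Ioc_eq_Ioc hst htu, setIntegral_union (Ioc_disjoint_Ioc_of_le le_rfl)
    measurableSet_Ioc (integrable_ballKernel_path hw k r y) (integrable_ballKernel_path hw k r y)]
  rfl

lemma tendsto_occDiff {d : ℕ} {w : ℝ → Rd d} (hw : Measurable w) (k : ℕ) {s t : ℝ} (hst : s < t)
    {σ τ : ℕ → ℝ} (hσ : Filter.Tendsto σ Filter.atTop (nhds s))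
    (hτ : Filter.Tendsto τ Filter.atTop (nhds t)) (r : ℝ) (y : Rd d) :
    Filter.Tendsto (fun n => occDiff k w (σ n) (τ n) r y) Filter.atTop
      (nhds (occDiff k w s t r y)) := by
  set g : ℝ → ℝ := fun u => ballKernel k r (w u - y)
  have hg : ∀ a b : ℝ, IntervalIntegrable g volume a b := fun a b =>
    ⟨integrable_ballKernel_path hw k r y, integrable_ballKernel_path hw k r y⟩
  have hcont : Continuous fun t => ∫ u in (0 : ℝ)..t, g u :=
    intervalIntegral.continuous_primitive hg 0
  have heq : ∀ {a b : ℝ}, a ≤ b → occDiff k w a b r y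
      = (∫ u in (0 : ℝ)..b, g u) - ∫ u in (0 : ℝ)..a, g u := fun {a b} hab => by
    rw [intervalIntegral.integral_interval_sub_left (hg _ _) (hg _ _),
      intervalIntegral.integral_of_le hab]
    rfl
  rw [heq hst.le]
  refine (((hcont.tendsto t).comp hτ).sub ((hcont.tendsto s).comp hσ)).congr' ?_
  filter_upwards [hσ.eventually_lt hτ hst] with n hn
  exact (heq hn.le).symm

/-! ### Small ball norms of occupation measures -/

lemma eLpNorm_two_sq {X E : Type*} [MeasurableSpace X] [TopologicalSpace E]
    [ContinuousENorm E] (f : X → E) (μ : Measure X) :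
    eLpNorm f 2 μ ^ 2 = ∫⁻ x, ‖f x‖ₑ ^ 2 ∂μ := by
  have := eLpNorm_nnreal_pow_eq_lintegral (f := f) (μ := μ) (p := 2) two_ne_zero
  simpa using this

/-- The function whose `L²` norm is the small ball norm of an occupation measure. -/
noncomputable def sbeFun {d : ℕ} (α : ℝ) (k : ℕ) (w : ℝ → Rd d) (s t : ℝ) (p : Rd d × ℝ) : ℝ :=
  p.2 ^ (-(α + d)) * occDiff k w s t p.2 p.1

lemma measurable_sbeFun {X : Type*} [MeasurableSpace X] {d : ℕ} (α : ℝ) (k : ℕ)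
    {W : ℝ → X → Rd d} (hW : Measurable (Function.uncurry W)) (s t : ℝ) {p : X → Rd d × ℝ}
    (hp : Measurable p) : Measurable fun x => sbeFun α k (fun u => W u x) s t (p x) := by
  have := measurable_occDiff k hW s t hp.snd hp.fst
  unfold sbeFun
  fun_prop

lemma measurable_sbeFun_path {d : ℕ} (α : ℝ) (k : ℕ) {w : ℝ → Rd d} (hw : Measurable w)
    (s t : ℝ) : Measurable (sbeFun α k w s t) :=
  measurable_sbeFun α k (W := fun u _ => w u) (hw.comp measurable_fst) s t measurable_id

/-- The small ball norm of an occupation measure, computed with `Δ_k`. -/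
noncomputable def occNorm {d : ℕ} (α : ℝ) (k : ℕ) (w : ℝ → Rd d) (s t : ℝ) : ℝ≥0∞ :=
  eLpNorm (sbeFun α k w s t) 2 (volume.prod drOverR)

lemma occNorm_sq {d : ℕ} (α : ℝ) (k : ℕ) {w : ℝ → Rd d} (hw : Measurable w) (s t : ℝ) :
    occNorm α k w s t ^ 2
      = ∫⁻ y : Rd d, eLpNorm (fun r => sbeFun α k w s t (y, r)) 2 drOverR ^ 2 := by
  have := measurable_sbeFun_path α k hw s t
  rw [occNorm, eLpNorm_two_sq, lintegral_prod _ (by fun_prop)]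
  simp_rw [eLpNorm_two_sq]

/-- Both exponents being 2, Tonelli merges the iterated norm into one `L²` norm on the product
space. -/
lemma sbeNorm_occupation {d : ℕ} (α : ℝ) {w : ℝ → Rd d} (hw : Measurable w) (s t : ℝ) :
    sbeNorm α 2 2 (occupation w s t) = occNorm α ⌈α + (d : ℝ) - 1⌉₊ w s t := by
  refine (ENNReal.pow_right_strictMono two_ne_zero).injective ?_
  rw [occNorm_sq _ _ hw, sbeNorm, eLpNorm_two_sq]
  simp_rw [enorm_eq_self, scaleDiff_ballMass_occupation hw, sbeFun, neg_add']

lemma occNorm_of_le {d : ℕ} (α : ℝ) (k : ℕ) (w : ℝ → Rd d) {s t : ℝ} (h : t ≤ s) :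
    occNorm α k w s t = 0 := by
  have : sbeFun α k w s t = 0 := by
    ext p
    simp [sbeFun, occDiff, Ioc_eq_empty_of_le h]
  rw [occNorm, this, eLpNorm_zero]

lemma occNorm_triangle {d : ℕ} (α : ℝ) (k : ℕ) {w : ℝ → Rd d} (hw : Measurable w) {s t u : ℝ}
    (hst : s ≤ t) (htu : t ≤ u) :
    occNorm α k w s u ≤ occNorm α k w s t + occNorm α k w t u := by
  have : sbeFun α k w s u = sbeFun α k w s t + sbeFun α k w t u := by
    ext p
    simp only [sbeFun, Pi.add_apply, occDiff_add hw k hst htu, mul_add]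
  rw [occNorm, this]
  exact eLpNorm_add_le (measurable_sbeFun_path α k hw _ _).aestronglyMeasurable
    (measurable_sbeFun_path α k hw _ _).aestronglyMeasurable one_le_two

/-- Fatou's lemma, from pointwise convergence. Lower semicontinuity in the endpoints suffices both
for chaining and for measurability, and holds even when the norms are infinite. -/
lemma occNorm_le_liminf {d : ℕ} (α : ℝ) (k : ℕ) {w : ℝ → Rd d} (hw : Measurable w) {s t : ℝ}
    (hst : s < t) {σ τ : ℕ → ℝ} (hσ : Filter.Tendsto σ Filter.atTop (nhds s))
    (hτ : Filter.Tendsto τ Filter.atTop (nhds t)) :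
    occNorm α k w s t ≤ Filter.liminf (fun n => occNorm α k w (σ n) (τ n)) Filter.atTop :=
  Lp.eLpNorm_lim_le_liminf_eLpNorm
    (fun _ => (measurable_sbeFun_path α k hw _ _).aestronglyMeasurable) _
    (.of_forall fun p => (tendsto_occDiff hw k hst hσ hτ p.2 p.1).const_mul _)

lemma measurable_occNorm {X : Type*} [MeasurableSpace X] {d : ℕ} (α : ℝ) (k : ℕ)
    {W : ℝ → X → Rd d} (hW : Measurable (Function.uncurry W)) (s t : ℝ) :
    Measurable fun x => occNorm α k (fun u => W u x) s t := by
  have h : ∀ x, occNorm α k (fun u => W u x) s t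
      = (∫⁻ p, ‖sbeFun α k (fun u => W u x) s t p‖ₑ ^ 2 ∂(volume.prod drOverR)) ^ (2⁻¹ : ℝ) := by
    intro x
    rw [← eLpNorm_two_sq, ← ENNReal.rpow_natCast, ← ENNReal.rpow_mul]
    simp [occNorm]
  simp_rw [h]
  refine Measurable.pow_const (Measurable.lintegral_prod_right' (f := fun q : X × (Rd d × ℝ) =>
    ‖sbeFun α k (fun u => W u q.1) s t q.2‖ₑ ^ 2) ?_) _
  have := measurable_sbeFun α k (X := X × (Rd d × ℝ)) (W := fun u q => W u q.1)
    (hW.comp (measurable_fst.prodMk (measurable_fst.comp measurable_snd))) s t measurable_snd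
  fun_prop

/-- Raising the order of the differences does not decrease the small ball norm, up to a
constant. -/
lemma exists_occNorm_sq_le_add {d : ℕ} {α : ℝ} {k : ℕ} (hα : 0 < α + d) (hk : α + d < k + 1)
    (n : ℕ) : ∃ C : ℝ≥0∞, C ≠ ∞ ∧ ∀ w : ℝ → Rd d, Measurable w → ∀ s t : ℝ,
      occNorm α k w s t ^ 2 ≤ C * occNorm α (k + n) w s t ^ 2 := by
  obtain ⟨C, hC, h⟩ := exists_eLpNorm_scaleDiff_le_add hα hk n
  refine ⟨C ^ 2, ENNReal.pow_ne_top hC, fun w hw s t => ?_⟩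
  rw [occNorm_sq _ _ hw, occNorm_sq _ _ hw, ← lintegral_const_mul' _ _ (ENNReal.pow_ne_top hC)]
  refine lintegral_mono fun y => ?_
  simp only
  rw [← mul_pow]
  gcongr
  simp only [sbeFun, ← scaleDiff_ballMass_occupation hw]
  exact h _ (measurable_ballMass_occupation hw s t y)
    ⟨_, fun ρ => abs_ballMass_occupation_le hw s t ρ y⟩

/-! ### Second moments -/

/-- The bound without cancellation, valid for every path: one factor of the square is estimated by
the supremum of the kernel, the other by its `L¹` norm. -/
lemma lintegral_sq_occDiff_le {d : ℕ} (k : ℕ) {w : ℝ → Rd d} (hw : Measurable w) {s t : ℝ}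
    (hst : s ≤ t) {r : ℝ} (hr : 0 < r) :
    ∫⁻ y : Rd d, ‖occDiff k w s t r y‖ₑ ^ 2
      ≤ ENNReal.ofReal (scaleDiffBound k ^ 2 * unitBallVol d * r ^ d * (t - s) ^ 2) := by
  have hC := scaleDiffBound_nonneg k
  have h1 : ∀ y, ‖occDiff k w s t r y‖ₑ ^ 2 ≤ ENNReal.ofReal (scaleDiffBound k * (t - s)) *
      ∫⁻ u in Ioc s t, ‖ballKernel k r (w u - y)‖ₑ := by
    intro y
    rw [sq]
    gcongr
    · rw [← ofReal_norm]
      refine ENNReal.ofReal_le_ofReal ?_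
      refine (norm_setIntegral_le_of_norm_le_const measure_Ioc_lt_top
        fun u _ => abs_ballKernel_le k r (w u - y)).trans_eq ?_
      rw [Real.volume_real_Ioc_of_le hst]
    · exact enorm_integral_le_lintegral_enorm _
  have h2 : ∀ u, ∫⁻ y, ‖ballKernel k r (w u - y)‖ₑ = ∫⁻ z : Rd d, ‖ballKernel k r z‖ₑ := fun u =>
    lintegral_sub_left_eq_self (fun z => ‖ballKernel k r z‖ₑ) (w u)
  calc ∫⁻ y : Rd d, ‖occDiff k w s t r y‖ₑ ^ 2
      ≤ ∫⁻ y, ENNReal.ofReal (scaleDiffBound k * (t - s)) *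
          ∫⁻ u in Ioc s t, ‖ballKernel k r (w u - y)‖ₑ := lintegral_mono h1
    _ = ENNReal.ofReal (scaleDiffBound k * (t - s)) *
          ∫⁻ _u in Ioc s t, ∫⁻ z : Rd d, ‖ballKernel k r z‖ₑ := by
        rw [lintegral_const_mul' _ _ ENNReal.ofReal_ne_top, lintegral_lintegral_swap]
        · simp_rw [h2]
        · exact Measurable.aemeasurable (by fun_prop)
    _ ≤ ENNReal.ofReal (scaleDiffBound k * (t - s)) *
          (ENNReal.ofReal (scaleDiffBound k * (r ^ d * unitBallVol d)) *
            ENNReal.ofReal (t - s)) := by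
        rw [setLIntegral_const, Real.volume_Ioc]
        gcongr
        exact lintegral_enorm_ballKernel_le k hr
    _ = _ := by
        have := unitBallVol_nonneg d
        rw [← ENNReal.ofReal_mul (by positivity),
          ← ENNReal.ofReal_mul (mul_nonneg hC (by linarith))]
        congr 1
        ring

/-- The `L²_y` norm of `Δ_k F_μ(r, ·)`, as a double integral over times. -/
lemma integral_sq_occDiff {d : ℕ} (k : ℕ) {w : ℝ → Rd d} (hw : Measurable w) (s t : ℝ)
    {r : ℝ} (hr : 0 < r) :
    Integrable (fun y : Rd d => occDiff k w s t r y ^ 2) ∧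
      ∫ y : Rd d, occDiff k w s t r y ^ 2 = ∫ z : ℝ × ℝ, ballCorr k r (w z.2 - w z.1)
          ∂((volume.restrict (Ioc s t)).prod (volume.restrict (Ioc s t))) := by
  set μ : Measure ℝ := volume.restrict (Ioc s t)
  set H : ℝ × ℝ → Rd d → ℝ := fun z y => ballKernel k r (w z.1 - y) * ballKernel k r (w z.2 - y)
  have hHm : Measurable (Function.uncurry H) := by
    simp only [H, Function.uncurry_def]
    fun_prop
  have hφ : ∀ u, Integrable (fun y => ballKernel k r (w u - y)) volume := fun u =>
    (integrable_ballKernel k hr).comp_sub_left (w u)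
  have hHi : ∀ z, Integrable (H z) volume := fun z =>
    (hφ z.1).mul_bdd (c := scaleDiffBound k) (hφ z.2).aestronglyMeasurable
      (.of_forall fun y => abs_ballKernel_le k r _)
  have hint : Integrable (Function.uncurry H) ((μ.prod μ).prod volume) := by
    rw [integrable_prod_iff hHm.aestronglyMeasurable]
    refine ⟨.of_forall hHi, Integrable.of_bound
      (StronglyMeasurable.integral_prod_right (ν := volume)
        (f := fun z y => ‖H z y‖) ?_).aestronglyMeasurable
      (scaleDiffBound k * ∫ y : Rd d, |ballKernel k r y|) (.of_forall fun z => ?_)⟩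
    · exact hHm.norm.stronglyMeasurable
    · rw [Real.norm_of_nonneg (integral_nonneg fun _ => norm_nonneg _)]
      calc ∫ y, ‖H z y‖ ≤ ∫ y, scaleDiffBound k * |ballKernel k r (w z.1 - y)| := by
            refine integral_mono (hHi z).norm ((hφ z.1).abs.const_mul _) fun y => ?_
            simp only [H, norm_mul, Real.norm_eq_abs]
            rw [mul_comm]
            exact mul_le_mul_of_nonneg_right (abs_ballKernel_le k r _) (abs_nonneg _)
        _ = _ := by
            rw [integral_const_mul,
              integral_sub_left_eq_self (fun y => |ballKernel k r y|) volume (w z.1)]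
  have hsq : ∀ y, occDiff k w s t r y ^ 2 = ∫ z, H z y ∂(μ.prod μ) := fun y => by
    rw [sq]
    exact (integral_prod_mul (fun u => ballKernel k r (w u - y))
      fun u => ballKernel k r (w u - y)).symm
  have hcorr : ∀ z, ballCorr k r (w z.2 - w z.1) = ∫ y, H z y := fun z => by
    rw [ballCorr, ← integral_sub_left_eq_self _ volume (w z.1)]
    refine integral_congr_ae (.of_forall fun y => ?_)
    simp only [H]
    congr 2
    abel
  simp_rw [hcorr, hsq]
  exact ⟨hint.integral_prod_right, (integral_integral_swap hint).symm⟩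

lemma lintegral_sq_occDiff_eq {d : ℕ} (k : ℕ) {w : ℝ → Rd d} (hw : Measurable w) (s t : ℝ)
    {r : ℝ} (hr : 0 < r) :
    ∫⁻ y : Rd d, ‖occDiff k w s t r y‖ₑ ^ 2
      = ENNReal.ofReal (∫ z : ℝ × ℝ, ballCorr k r (w z.2 - w z.1)
          ∂((volume.restrict (Ioc s t)).prod (volume.restrict (Ioc s t)))) := by
  obtain ⟨hint, heq⟩ := integral_sq_occDiff k hw s t hr
  rw [← heq, ofReal_integral_eq_lintegral_ofReal hint (.of_forall fun y => sq_nonneg _)]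
  refine lintegral_congr fun y => ?_
  rw [← ofReal_norm, ← ENNReal.ofReal_pow (norm_nonneg _), Real.norm_eq_abs, sq_abs]

/-- The expectation passes inside the double time integral, where it becomes the integral of
`ballCorr` against the law of an increment. -/
lemma lintegral_lintegral_sq_occDiff_le {d k : ℕ} {β : ℝ} (hβ : 0 ≤ β) (hk : d + ⌊β⌋₊ ≤ k)
    {Ω : Type*} [MeasurableSpace Ω] (P : Measure Ω) [IsProbabilityMeasure P]
    {W : ℝ → Ω → Rd d} (hW : Measurable (Function.uncurry W)) {a b Cν : ℝ}
    (hlaw : IncrementLawBound P a b W β Cν) {s t : ℝ} (has : a ≤ s) (hst : s ≤ t) (htb : t ≤ b)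
    {r : ℝ} (hr : 0 < r) :
    ∫⁻ x, (∫⁻ y : Rd d, ‖occDiff k (fun u => W u x) s t r y‖ₑ ^ 2) ∂P
      ≤ ENNReal.ofReal ((scaleDiffBound k * unitBallVol d) ^ 2 * r ^ (2 * d + β)) *
        ENNReal.ofReal (Cν * (t - s)) := by
  set μ : Measure ℝ := volume.restrict (Ioc s t)
  set A := ENNReal.ofReal ((scaleDiffBound k * unitBallVol d) ^ 2 * r ^ (2 * d + β))
  have hWx : ∀ x, Measurable fun u => W u x := fun x => hW.comp measurable_prodMk_right
  have hWu : ∀ u, Measurable (W u) := fun u => hW.comp measurable_prodMk_left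
  have hQm : Measurable fun q : Ω × (ℝ × ℝ) => ballCorr k r (W q.2.2 q.1 - W q.2.1 q.1) := by
    refine (measurable_ballCorr k r).comp (Measurable.sub ?_ ?_)
    · exact hW.comp (measurable_snd.snd.prodMk measurable_fst)
    · exact hW.comp (measurable_snd.fst.prodMk measurable_fst)
  have hQi : Integrable (fun q : Ω × (ℝ × ℝ) => ballCorr k r (W q.2.2 q.1 - W q.2.1 q.1))
      (P.prod (μ.prod μ)) :=
    Integrable.of_bound hQm.aestronglyMeasurable _ (.of_forall fun q => abs_ballCorr_le k hr _)
  have hnn : ∀ x, 0 ≤ ∫ z : ℝ × ℝ, ballCorr k r (W z.2 x - W z.1 x) ∂(μ.prod μ) := fun x => by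
    rw [← (integral_sq_occDiff k (hWx x) s t hr).2]
    exact integral_nonneg fun y => sq_nonneg _
  simp_rw [lintegral_sq_occDiff_eq k (hWx _) s t hr]
  rw [← ofReal_integral_eq_lintegral_ofReal hQi.integral_prod_left (.of_forall hnn),
    integral_integral_swap hQi]
  calc ENNReal.ofReal (∫ z, ∫ x, ballCorr k r (W z.2 x - W z.1 x) ∂P ∂(μ.prod μ))
      ≤ ‖∫ z, ∫ x, ballCorr k r (W z.2 x - W z.1 x) ∂P ∂(μ.prod μ)‖ₑ :=
        Real.ofReal_le_enorm _
    _ ≤ ∫⁻ z, ‖∫ x, ballCorr k r (W z.2 x - W z.1 x) ∂P‖ₑ ∂(μ.prod μ) :=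
        enorm_integral_le_lintegral_enorm _
    _ ≤ ∫⁻ z, A * measureHolderNorm β (P.map fun x => W z.2 x - W z.1 x) ∂(μ.prod μ) := by
        refine lintegral_mono fun z => ?_
        have hm : Measurable fun x => W z.2 x - W z.1 x := (hWu _).sub (hWu _)
        have := Measure.isProbabilityMeasure_map (μ := P) hm.aemeasurable
        refine le_trans (le_of_eq ?_) (enorm_integral_ballCorr_le hβ hk _ hr)
        rw [integral_map hm.aemeasurable (measurable_ballCorr k r).aestronglyMeasurable]
    _ = A * ∫⁻ z in Ioc s t ×ˢ Ioc s t,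
          measureHolderNorm β (P.map fun x => W z.2 x - W z.1 x) := by
        rw [lintegral_const_mul' _ _ ENNReal.ofReal_ne_top, Measure.prod_restrict]
        rfl
    _ ≤ A * ∫⁻ z in Icc s t ×ˢ Icc s t,
          measureHolderNorm β (P.map fun x => W z.2 x - W z.1 x) := by
        gcongr <;> exact Ioc_subset_Icc_self
    _ ≤ _ := by
        gcongr
        exact hlaw s t has hst htb

/-- Tonelli with the scale `r` outermost, so that second moments at a fixed scale can be inserted.
-/
lemma lintegral_occNorm_sq_eq {Ω : Type*} [MeasurableSpace Ω] (P : Measure Ω) [SFinite P] {d : ℕ}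
    (α : ℝ) (k : ℕ) {W : ℝ → Ω → Rd d} (hW : Measurable (Function.uncurry W)) (s t : ℝ) :
    ∫⁻ x, occNorm α k (fun u => W u x) s t ^ 2 ∂P
      = ∫⁻ r in Ioi 0, ENNReal.ofReal r⁻¹ * (‖r ^ (-(α + d))‖ₑ ^ 2 *
          ∫⁻ x, (∫⁻ y : Rd d, ‖occDiff k (fun u => W u x) s t r y‖ₑ ^ 2) ∂P) := by
  have hm : Measurable fun q : (Ω × ℝ) × Rd d =>
      ‖occDiff k (fun u => W u q.1.1) s t q.1.2 q.2‖ₑ ^ 2 := by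
    have := measurable_occDiff k (X := (Ω × ℝ) × Rd d) (W := fun u q => W u q.1.1)
      (hW.comp (measurable_fst.prodMk measurable_snd.fst.fst)) s t
      measurable_fst.snd measurable_snd
    fun_prop
  have hm2 : Measurable fun q : Ω × ℝ =>
      ∫⁻ y : Rd d, ‖occDiff k (fun u => W u q.1) s t q.2 y‖ₑ ^ 2 := hm.lintegral_prod_right'
  have hm3 : Measurable fun r : ℝ =>
      ∫⁻ x, (∫⁻ y : Rd d, ‖occDiff k (fun u => W u x) s t r y‖ₑ ^ 2) ∂P :=
    hm2.lintegral_prod_left'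
  rw [← lintegral_drOverR (by fun_prop)]
  have h1 : ∀ x, occNorm α k (fun u => W u x) s t ^ 2 = ∫⁻ r, ‖r ^ (-(α + d))‖ₑ ^ 2 *
      (∫⁻ y : Rd d, ‖occDiff k (fun u => W u x) s t r y‖ₑ ^ 2) ∂drOverR := by
    intro x
    have hwx : Measurable fun u => W u x := hW.comp measurable_prodMk_right
    have := measurable_sbeFun_path α k hwx s t
    rw [occNorm, eLpNorm_two_sq, lintegral_prod_symm _ (by fun_prop)]
    refine lintegral_congr fun r => ?_
    simp_rw [sbeFun, enorm_mul, mul_pow]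
    rw [lintegral_const_mul' _ _ (ENNReal.pow_ne_top enorm_ne_top)]
  simp_rw [h1]
  rw [lintegral_lintegral_swap]
  · refine lintegral_congr fun r => ?_
    rw [lintegral_const_mul' _ _ (ENNReal.pow_ne_top enorm_ne_top)]
  · refine Measurable.aemeasurable ?_
    simp only [Function.uncurry_def]
    fun_prop

/-- Interpolation between the bound of the expectation by the regularity of the increments and the
bound by the length of the time interval. -/
lemma exists_lintegral_occNorm_sq_le (d k : ℕ) {a b α β δ : ℝ} (hα : 0 < α)
    (hβ : 0 ≤ β) (hδ : 0 < δ) (hδ1 : δ < 1) (hδβ : δ * (β + d) < β - 2 * α)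
    (hk : d + ⌊β⌋₊ ≤ k) :
    ∃ K : ℝ≥0∞, K ≠ ∞ ∧ ∀ (Ω : Type*) [MeasurableSpace Ω] (P : Measure Ω) [IsProbabilityMeasure P]
      (W : ℝ → Ω → Rd d) (Cν : ℝ), 0 ≤ Cν → Measurable (Function.uncurry W) →
      IncrementLawBound P a b W β Cν → ∀ s t : ℝ, a ≤ s → s ≤ t → t ≤ b →
      ∫⁻ x, occNorm α k (fun u => W u x) s t ^ 2 ∂P
        ≤ K * (1 + ENNReal.ofReal Cν ^ (1 - δ)) * ENNReal.ofReal (t - s) ^ (1 + δ) := by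
  set A := (scaleDiffBound k * unitBallVol d) ^ 2 with hA
  set B := scaleDiffBound k ^ 2 * unitBallVol d with hB
  have hA0 : 0 ≤ A := sq_nonneg _
  have hB0 : 0 ≤ B := mul_nonneg (sq_nonneg _) (unitBallVol_nonneg d)
  -- The interpolated integrand is of order `r ^ (η - 1)` at zero, so `η > 0` is the convergence
  -- condition.
  set η := β - 2 * α - δ * (β + d) with hη
  have hη0 : 0 < η := by linarith
  set I₁ := ∫⁻ r in Ioc (0 : ℝ) 1, ENNReal.ofReal (A ^ (1 - δ) * B ^ δ * r ^ (η - 1)) with hI₁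
  set I₂ := ∫⁻ r in Ioi (1 : ℝ), ENNReal.ofReal (B * r ^ (-1 - 2 * α - d)) with hI₂
  have hI₁t : I₁ ≠ ∞ := by
    have h : IntegrableOn (fun r : ℝ => A ^ (1 - δ) * B ^ δ * r ^ (η - 1)) (Ioc 0 1) := by
      refine Integrable.const_mul ?_ _
      rw [← IntegrableOn, ← intervalIntegrable_iff_integrableOn_Ioc_of_le zero_le_one]
      exact intervalIntegral.intervalIntegrable_rpow' (by linarith)
    exact h.lintegral_lt_top.ne
  have hI₂t : I₂ ≠ ∞ := by
    have h : IntegrableOn (fun r : ℝ => B * r ^ (-1 - 2 * α - d)) (Ioi 1) := by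
      refine Integrable.const_mul (integrableOn_Ioi_rpow_of_lt ?_ one_pos) _
      have : (0 : ℝ) ≤ d := d.cast_nonneg
      linarith
    exact h.lintegral_lt_top.ne
  refine ⟨I₁ + I₂ * ENNReal.ofReal (b - a) ^ (1 - δ), ENNReal.add_ne_top.2 ⟨hI₁t,
    ENNReal.mul_ne_top hI₂t (ENNReal.rpow_ne_top_of_nonneg (by linarith) ENNReal.ofReal_ne_top)⟩,
    fun Ω _ P _ W Cν hC hW hlaw s t has hst htb => ?_⟩
  have hWx : ∀ x, Measurable fun u => W u x := fun x => hW.comp measurable_prodMk_right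
  set T : ℝ → ℝ≥0∞ := fun r =>
    ∫⁻ x, (∫⁻ y : Rd d, ‖occDiff k (fun u => W u x) s t r y‖ₑ ^ 2) ∂P with hT
  set D := ENNReal.ofReal (t - s) with hD
  set E := ENNReal.ofReal Cν with hE
  have hT₁ : ∀ r, 0 < r → T r ≤ ENNReal.ofReal (B * r ^ d) * D ^ (2 : ℝ) := by
    intro r hr
    calc T r ≤ ∫⁻ _x, ENNReal.ofReal (B * r ^ d * (t - s) ^ 2) ∂P :=
          lintegral_mono fun x => lintegral_sq_occDiff_le k (hWx x) hst hr
      _ = _ := by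
          rw [lintegral_const, measure_univ, mul_one, ENNReal.ofReal_mul (by positivity),
            ENNReal.ofReal_pow (by linarith), ENNReal.rpow_ofNat]
  have hT₂ : ∀ r, 0 < r → T r ≤ ENNReal.ofReal (A * r ^ (2 * d + β)) * (E * D) := by
    intro r hr
    rw [hE, hD, ← ENNReal.ofReal_mul hC]
    exact lintegral_lintegral_sq_occDiff_le hβ hk P hW hlaw has hst htb hr
  have hw : ∀ r : ℝ, 0 < r → ENNReal.ofReal r⁻¹ * ‖r ^ (-(α + d))‖ₑ ^ 2
      = ENNReal.ofReal (r ^ (-1 - 2 * α - 2 * d)) := by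
    intro r hr
    rw [← ofReal_norm, ← ENNReal.ofReal_pow (norm_nonneg _), ← ENNReal.ofReal_mul (by positivity),
      Real.norm_of_nonneg (by positivity), ← Real.rpow_neg_one, sq, ← Real.rpow_add hr,
      ← Real.rpow_add hr]
    congr 2
    ring
  have hsmall : ∀ r ∈ Ioc (0 : ℝ) 1, ENNReal.ofReal r⁻¹ * (‖r ^ (-(α + d))‖ₑ ^ 2 * T r)
      ≤ ENNReal.ofReal (A ^ (1 - δ) * B ^ δ * r ^ (η - 1)) * (E ^ (1 - δ) * D ^ (1 + δ)) := by
    intro r hr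
    have hr0 := hr.1
    rw [← mul_assoc, hw r hr0]
    calc ENNReal.ofReal (r ^ (-1 - 2 * α - 2 * d)) * T r
        = ENNReal.ofReal (r ^ (-1 - 2 * α - 2 * d)) * (T r ^ (1 - δ) * T r ^ δ) := by
          rw [← ENNReal.rpow_add_of_nonneg _ _ (by linarith) hδ.le]
          simp
      _ ≤ ENNReal.ofReal (r ^ (-1 - 2 * α - 2 * d)) *
          ((ENNReal.ofReal (A * r ^ (2 * d + β)) * (E * D)) ^ (1 - δ) *
            (ENNReal.ofReal (B * r ^ d) * D ^ (2 : ℝ)) ^ δ) := by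
          gcongr
          · exact hT₂ r hr0
          · exact hT₁ r hr0
      _ = _ := by
          have h1δ : 0 ≤ 1 - δ := by linarith
          rw [ENNReal.mul_rpow_of_nonneg _ _ h1δ, ENNReal.mul_rpow_of_nonneg _ _ h1δ,
            ENNReal.mul_rpow_of_nonneg _ _ hδ.le, ← ENNReal.rpow_mul,
            ENNReal.ofReal_rpow_of_nonneg (by positivity) h1δ,
            ENNReal.ofReal_rpow_of_nonneg (by positivity) hδ.le,
            show 1 + δ = (1 - δ) + 2 * δ by ring,
            ENNReal.rpow_add_of_nonneg _ _ h1δ (by linarith : (0 : ℝ) ≤ 2 * δ)]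
          have : A ^ (1 - δ) * B ^ δ * r ^ (η - 1) = r ^ (-1 - 2 * α - 2 * d) *
              ((A * r ^ (2 * d + β)) ^ (1 - δ) * (B * r ^ d) ^ δ) := by
            rw [Real.mul_rpow hA0 (by positivity), Real.mul_rpow hB0 (by positivity),
              ← Real.rpow_mul hr0.le, ← Real.rpow_natCast r d, ← Real.rpow_mul hr0.le,
              show η - 1 = (-1 - 2 * α - 2 * d) + ((2 * d + β) * (1 - δ) + d * δ) by
                rw [hη]; ring, Real.rpow_add hr0, Real.rpow_add hr0]
            ring
          rw [this, ENNReal.ofReal_mul (by positivity), ENNReal.ofReal_mul (by positivity)]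
          ring
  -- At large scales the pathwise bound is already integrable; the surplus factor `D ^ (1 - δ)` is
  -- at most the same power of `b - a`.
  have hlarge : ∀ r ∈ Ioi (1 : ℝ), ENNReal.ofReal r⁻¹ * (‖r ^ (-(α + d))‖ₑ ^ 2 * T r)
      ≤ ENNReal.ofReal (B * r ^ (-1 - 2 * α - d)) *
        (ENNReal.ofReal (b - a) ^ (1 - δ) * D ^ (1 + δ)) := by
    intro r hr
    have hr0 : 0 < r := one_pos.trans hr
    rw [← mul_assoc, hw r hr0]
    calc ENNReal.ofReal (r ^ (-1 - 2 * α - 2 * d)) * T r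
        ≤ ENNReal.ofReal (r ^ (-1 - 2 * α - 2 * d)) *
          (ENNReal.ofReal (B * r ^ d) * D ^ (2 : ℝ)) := by
          gcongr
          exact hT₁ r hr0
      _ = ENNReal.ofReal (B * r ^ (-1 - 2 * α - d)) * (D ^ (1 - δ) * D ^ (1 + δ)) := by
          rw [← mul_assoc, ← ENNReal.ofReal_mul (by positivity),
            ← ENNReal.rpow_add_of_nonneg _ _ (by linarith) (by linarith),
            show -1 - 2 * α - d = (-1 - 2 * α - 2 * d) + (d : ℝ) by ring, Real.rpow_add hr0,
            Real.rpow_natCast]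
          ring_nf
      _ ≤ _ := by
          gcongr
          exact ENNReal.ofReal_le_ofReal (by linarith)
  rw [lintegral_occNorm_sq_eq P α k hW, ← Ioc_union_Ioi_eq_Ioi (zero_le_one (α := ℝ)),
    lintegral_union measurableSet_Ioi Ioc_disjoint_Ioi_same]
  calc _ ≤ I₁ * (E ^ (1 - δ) * D ^ (1 + δ))
        + I₂ * (ENNReal.ofReal (b - a) ^ (1 - δ) * D ^ (1 + δ)) := by
        rw [hI₁, hI₂, ← lintegral_mul_const _ (by fun_prop), ← lintegral_mul_const _ (by fun_prop)]
        exact add_le_add (setLIntegral_mono (by fun_prop) hsmall)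
          (setLIntegral_mono (by fun_prop) hlarge)
    _ = (I₁ * E ^ (1 - δ) + I₂ * ENNReal.ofReal (b - a) ^ (1 - δ)) * D ^ (1 + δ) := by ring
    _ ≤ _ := by
        gcongr
        rw [mul_add, mul_one, add_comm]
        refine add_le_add le_add_self ?_
        gcongr
        exact le_self_add

/-! ### Dyadic chaining -/

/-- The dyadic point `i / 2^m`. -/
noncomputable def dyadic (m i : ℕ) : ℝ := (i : ℝ) / 2 ^ m

lemma dyadic_two_mul (m i : ℕ) : dyadic (m + 1) (2 * i) = dyadic m i := by
  rw [dyadic, dyadic, pow_succ]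
  push_cast
  field_simp

lemma dyadic_mono (m : ℕ) : Monotone (dyadic m) := fun i j h => by
  unfold dyadic
  gcongr

open Classical in
/-- The sum of the squares of the sizes of the dyadic intervals of level `m` inside `[s, t]`. -/
noncomputable def dyadicSq (n : ℝ → ℝ → ℝ≥0∞) (m : ℕ) (s t : ℝ) : ℝ≥0∞ :=
  ∑ i ∈ Finset.range (2 ^ m), if s ≤ dyadic m i ∧ dyadic m (i + 1) ≤ t then
    n (dyadic m i) (dyadic m (i + 1)) ^ 2 else 0

lemma le_rpow_half_of_sq_le {x y : ℝ≥0∞} (h : x ^ 2 ≤ y) : x ≤ y ^ (2⁻¹ : ℝ) := by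
  rw [ENNReal.le_rpow_inv_iff two_pos]
  simpa using h

lemma le_dyadicSq (n : ℝ → ℝ → ℝ≥0∞) {m i : ℕ} {s t : ℝ} (hi : i < 2 ^ m)
    (hs : s ≤ dyadic m i) (ht : dyadic m (i + 1) ≤ t) :
    n (dyadic m i) (dyadic m (i + 1)) ≤ dyadicSq n m s t ^ (2⁻¹ : ℝ) := by
  refine le_rpow_half_of_sq_le ?_
  refine le_trans ?_ (Finset.single_le_sum (fun _ _ => zero_le) (Finset.mem_range.2 hi))
  rw [if_pos ⟨hs, ht⟩]

/-- Passing to level `m + 1`, the largest union of dyadic intervals inside `[s, t]` gains at most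
one interval at each end. -/
lemma chain_step {n : ℝ → ℝ → ℝ≥0∞} (h0 : ∀ s t, t ≤ s → n s t = 0)
    (htri : ∀ s t u, s ≤ t → t ≤ u → n s u ≤ n s t + n t u) {s t : ℝ} (hs : 0 ≤ s)
    (ht0 : 0 ≤ t) (ht : t ≤ 1) (m : ℕ) :
    n (dyadic (m + 1) ⌈s * 2 ^ (m + 1)⌉₊) (dyadic (m + 1) ⌊t * 2 ^ (m + 1)⌋₊)
      ≤ n (dyadic m ⌈s * 2 ^ m⌉₊) (dyadic m ⌊t * 2 ^ m⌋₊)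
        + 2 * dyadicSq n (m + 1) s t ^ (2⁻¹ : ℝ) := by
  set p := ⌈s * 2 ^ m⌉₊
  set q := ⌊t * 2 ^ m⌋₊
  set p' := ⌈s * 2 ^ (m + 1)⌉₊
  set q' := ⌊t * 2 ^ (m + 1)⌋₊
  set S := dyadicSq n (m + 1) s t ^ (2⁻¹ : ℝ)
  have hp : s * 2 ^ m ≤ p := Nat.le_ceil _
  have hp' : s * 2 ^ (m + 1) ≤ p' := Nat.le_ceil _
  have hq : q ≤ t * 2 ^ m := Nat.floor_le (by positivity)
  have hq' : q' ≤ t * 2 ^ (m + 1) := Nat.floor_le (by positivity)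
  have h1 : p' ≤ 2 * p := Nat.ceil_le.2 (by push_cast; rw [pow_succ]; linarith)
  -- With truncated subtraction this is equivalent to `2 * p ≤ p' + 1`.
  have h2 : p < p' + 1 - p + 1 := by
    have : ((p : ℕ) : ℝ) < s * 2 ^ m + 1 := Nat.ceil_lt_add_one (by positivity)
    have h3 : (2 * p : ℝ) < p' + 2 := by rw [pow_succ] at hp'; linarith
    have h4 : 2 * p < p' + 2 := by exact_mod_cast h3
    omega
  have h3 : 2 * q ≤ q' := Nat.le_floor (by push_cast; rw [pow_succ]; linarith)
  have h4 : q' < 2 * q + 2 := by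
    have : t * 2 ^ m < (q : ℕ) + 1 := Nat.lt_floor_add_one _
    have h3 : (q' : ℝ) < 2 * q + 2 := by rw [pow_succ] at hq'; linarith
    exact_mod_cast h3
  have h5 : q' ≤ 2 ^ (m + 1) := by
    have : (q' : ℝ) ≤ 2 ^ (m + 1) := hq'.trans (mul_le_of_le_one_left (by positivity) ht)
    exact_mod_cast this
  have h6 : s ≤ dyadic (m + 1) p' := by rwa [dyadic, le_div_iff₀ (by positivity)]
  have h7 : dyadic (m + 1) q' ≤ t := by rwa [dyadic, div_le_iff₀ (by positivity)]
  rcases le_or_gt q' p' with h | h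
  · rw [h0 _ _ (dyadic_mono _ h)]
    exact zero_le
  have hpq : p ≤ q := by omega
  rw [← dyadic_two_mul m p, ← dyadic_two_mul m q]
  have hl : n (dyadic (m + 1) p') (dyadic (m + 1) (2 * p)) ≤ S := by
    rcases (show 2 * p = p' ∨ 2 * p = p' + 1 by omega) with e | e
    · rw [e, h0 _ _ le_rfl]
      exact zero_le
    · rw [e]
      exact le_dyadicSq n (by omega) h6 ((dyadic_mono _ h).trans h7)
  have hr : n (dyadic (m + 1) (2 * q)) (dyadic (m + 1) q') ≤ S := by
    rcases (show q' = 2 * q ∨ q' = 2 * q + 1 by omega) with e | e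
    · rw [e, h0 _ _ le_rfl]
      exact zero_le
    · rw [e] at h5 h7 ⊢
      exact le_dyadicSq n (by omega) (h6.trans (dyadic_mono _ (by omega))) h7
  calc _ ≤ n (dyadic (m + 1) p') (dyadic (m + 1) (2 * p))
        + (n (dyadic (m + 1) (2 * p)) (dyadic (m + 1) (2 * q))
          + n (dyadic (m + 1) (2 * q)) (dyadic (m + 1) q')) := by
        refine (htri _ _ _ (dyadic_mono _ h1) (dyadic_mono _ (by omega))).trans ?_
        gcongr
        exact htri _ _ _ (dyadic_mono _ (by omega)) (dyadic_mono _ h3)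
    _ ≤ S + (n (dyadic (m + 1) (2 * p)) (dyadic (m + 1) (2 * q)) + S) := by gcongr
    _ = _ := by ring

lemma chain_sum {n : ℝ → ℝ → ℝ≥0∞} (h0 : ∀ s t, t ≤ s → n s t = 0)
    (htri : ∀ s t u, s ≤ t → t ≤ u → n s u ≤ n s t + n t u) {s t : ℝ} (hs : 0 ≤ s)
    (ht0 : 0 ≤ t) (ht : t ≤ 1) (m : ℕ) :
    n (dyadic m ⌈s * 2 ^ m⌉₊) (dyadic m ⌊t * 2 ^ m⌋₊)
      ≤ ∑ i ∈ Finset.range (m + 1), 2 * dyadicSq n i s t ^ (2⁻¹ : ℝ) := by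
  induction m with
  | zero =>
    rw [zero_add, Finset.sum_range_one]
    have hp : s ≤ ⌈s * 2 ^ 0⌉₊ := by simpa using Nat.le_ceil s
    have hq : (⌊t * 2 ^ 0⌋₊ : ℝ) ≤ t := by simpa using Nat.floor_le ht0
    set p := ⌈s * 2 ^ 0⌉₊
    set q := ⌊t * 2 ^ 0⌋₊
    rcases le_or_gt q p with h | h
    · rw [h0 _ _ (dyadic_mono _ h)]
      exact zero_le
    have hq1 : q ≤ 1 := by exact_mod_cast hq.trans ht
    obtain ⟨hp0, hq1⟩ : p = 0 ∧ q = p + 1 := by omega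
    rw [hq1] at hq ⊢
    refine (le_dyadicSq n (by omega) (by simpa [dyadic] using hp) ?_).trans
      (le_mul_of_one_le_left' one_le_two)
    simpa [dyadic] using hq
  | succ m ih =>
    rw [Finset.sum_range_succ]
    exact (chain_step h0 htri hs ht0 ht m).trans (by gcongr)

/-- Cauchy–Schwarz against the geometric sequence `l ^ i`. Level `i` pays a factor `l ^ (-2 * i)`,
to be compensated by the moment bound. -/
lemma sq_sum_le_weighted (l : ℝ≥0∞) (hl0 : l ≠ 0) (hl1 : l < 1) (x : ℕ → ℝ≥0∞) (m : ℕ) :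
    (∑ i ∈ Finset.range m, x i) ^ 2
      ≤ (1 - l ^ 2)⁻¹ * ∑' i, (l⁻¹ ^ 2) ^ i * x i ^ 2 := by
  have hlt : l ≠ ∞ := (hl1.trans ENNReal.one_lt_top).ne
  have h := ENNReal.inner_le_Lp_mul_Lq (Finset.range m) (fun i => l ^ i) (fun i => l⁻¹ ^ i * x i)
    Real.HolderConjugate.two_two
  have h1 : ∀ i, l ^ i * (l⁻¹ ^ i * x i) = x i := fun i => by
    rw [← mul_assoc, ← mul_pow, ENNReal.mul_inv_cancel hl0 hlt, one_pow, one_mul]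
  simp_rw [h1] at h
  have h2 := pow_le_pow_left₀ zero_le h 2
  rw [mul_pow] at h2
  have h3 : ∀ z : ℝ≥0∞, (z ^ (1 / 2 : ℝ)) ^ 2 = z := fun z => by
    rw [← ENNReal.rpow_natCast, ← ENNReal.rpow_mul]
    simp
  rw [h3, h3] at h2
  refine h2.trans (mul_le_mul' ?_ ?_)
  · rw [← ENNReal.tsum_geometric]
    refine le_trans (le_of_eq (Finset.sum_congr rfl fun i _ => ?_)) (ENNReal.sum_le_tsum _)
    rw [ENNReal.rpow_ofNat]
    ring
  · refine le_trans (le_of_eq (Finset.sum_congr rfl fun i _ => ?_)) (ENNReal.sum_le_tsum _)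
    rw [ENNReal.rpow_ofNat]
    ring

/-- The interval is exhausted from inside, rounding `s` up and `t` down, so only dyadic intervals
contained in `[s, t]` are charged; lower semicontinuity gives the limit. -/
lemma sq_le_tsum_dyadicSq {n : ℝ → ℝ → ℝ≥0∞} (h0 : ∀ s t, t ≤ s → n s t = 0)
    (htri : ∀ s t u, s ≤ t → t ≤ u → n s u ≤ n s t + n t u)
    (hlsc : ∀ s t, s < t → ∀ σ τ : ℕ → ℝ, Filter.Tendsto σ Filter.atTop (nhds s) →
      Filter.Tendsto τ Filter.atTop (nhds t) →
      n s t ≤ Filter.liminf (fun i => n (σ i) (τ i)) Filter.atTop)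
    (l : ℝ≥0∞) (hl0 : l ≠ 0) (hl1 : l < 1) {s t : ℝ} (hs : 0 ≤ s) (hst : s < t) (ht : t ≤ 1) :
    n s t ^ 2 ≤ 4 * (1 - l ^ 2)⁻¹ * ∑' m, (l⁻¹ ^ 2) ^ m * dyadicSq n m s t := by
  set R := 4 * (1 - l ^ 2)⁻¹ * ∑' m, (l⁻¹ ^ 2) ^ m * dyadicSq n m s t with hR
  have ht0 : 0 ≤ t := hs.trans hst.le
  have hbound : ∀ m, n (dyadic m ⌈s * 2 ^ m⌉₊) (dyadic m ⌊t * 2 ^ m⌋₊) ≤ R ^ (2⁻¹ : ℝ) := by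
    intro m
    refine le_rpow_half_of_sq_le ?_
    refine (pow_le_pow_left₀ zero_le (chain_sum h0 htri hs ht0 ht m) 2).trans ?_
    refine (sq_sum_le_weighted l hl0 hl1 _ _).trans (le_of_eq ?_)
    have : ∀ i, (2 * dyadicSq n i s t ^ (2⁻¹ : ℝ)) ^ 2 = 4 * dyadicSq n i s t := fun i => by
      rw [mul_pow, ← ENNReal.rpow_natCast (_ ^ _), ← ENNReal.rpow_mul]
      norm_num
    simp_rw [this, hR, mul_left_comm _ (4 : ℝ≥0∞), ENNReal.tsum_mul_left]
    ring
  have hpow : Filter.Tendsto (fun m : ℕ => (2 : ℝ) ^ m) Filter.atTop Filter.atTop :=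
    tendsto_pow_atTop_atTop_of_one_lt one_lt_two
  have h1 := hlsc s t hst _ _ ((tendsto_nat_ceil_mul_div_atTop hs).comp hpow)
    ((tendsto_nat_floor_mul_div_atTop ht0).comp hpow)
  have h2 : n s t ≤ R ^ (2⁻¹ : ℝ) := by
    refine h1.trans (Filter.liminf_le_of_le (by isBoundedDefault) fun b hb => ?_)
    obtain ⟨m, hm⟩ := hb.exists
    exact hm.trans (hbound m)
  calc n s t ^ 2 ≤ (R ^ (2⁻¹ : ℝ)) ^ 2 := by gcongr
    _ = R := by
      rw [← ENNReal.rpow_natCast, ← ENNReal.rpow_mul]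
      simp

/-- A dyadic interval has positive length, so it lies in at most one interval of the partition. -/
lemma sum_dyadicSq_le (n : ℝ → ℝ → ℝ≥0∞) (m : ℕ) {N : ℕ} {t : Fin (N + 1) → ℝ}
    (ht : StrictMono t) :
    ∑ h : Fin N, dyadicSq n m (t h.castSucc) (t h.succ)
      ≤ ∑ i ∈ Finset.range (2 ^ m), n (dyadic m i) (dyadic m (i + 1)) ^ 2 := by
  classical
  simp_rw [dyadicSq]
  rw [Finset.sum_comm]
  refine Finset.sum_le_sum fun i _ => ?_
  rw [← Finset.sum_filter, Finset.sum_const]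
  refine (nsmul_le_nsmul_left zero_le (?_ : _ ≤ 1)).trans (one_nsmul _).le
  have key : ∀ h h' : Fin N, t h.castSucc ≤ dyadic m i ∧ dyadic m (i + 1) ≤ t h.succ →
      t h'.castSucc ≤ dyadic m i ∧ dyadic m (i + 1) ≤ t h'.succ → ¬ h < h' := by
    intro h h' H H' hlt
    have h1 : t h.succ ≤ t h'.castSucc := ht.monotone (by
      rw [Fin.le_def]; simp; exact hlt)
    have h2 : dyadic m i < dyadic m (i + 1) := by
      unfold dyadic
      gcongr
      simp
    linarith [H.2, H'.1]
  refine Finset.card_le_one.2 fun h hh h' hh' => ?_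
  have H := (Finset.mem_filter.1 hh).2
  have H' := (Finset.mem_filter.1 hh').2
  exact le_antisymm (not_lt.1 (key _ _ H' H)) (not_lt.1 (key _ _ H H'))

/-- The sum of squares over any partition of `[0, 1]` is controlled by dyadic intervals. -/
lemma sum_sq_le_tsum_dyadic {n : ℝ → ℝ → ℝ≥0∞} (h0 : ∀ s t, t ≤ s → n s t = 0)
    (htri : ∀ s t u, s ≤ t → t ≤ u → n s u ≤ n s t + n t u)
    (hlsc : ∀ s t, s < t → ∀ σ τ : ℕ → ℝ, Filter.Tendsto σ Filter.atTop (nhds s) →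
      Filter.Tendsto τ Filter.atTop (nhds t) →
      n s t ≤ Filter.liminf (fun i => n (σ i) (τ i)) Filter.atTop)
    (l : ℝ≥0∞) (hl0 : l ≠ 0) (hl1 : l < 1) {N : ℕ} {t : Fin (N + 1) → ℝ} (ht : StrictMono t)
    (ht0 : 0 ≤ t 0) (ht1 : t (Fin.last N) ≤ 1) :
    ∑ h : Fin N, n (t h.castSucc) (t h.succ) ^ 2
      ≤ 4 * (1 - l ^ 2)⁻¹ * ∑' m, (l⁻¹ ^ 2) ^ m *
        ∑ i ∈ Finset.range (2 ^ m), n (dyadic m i) (dyadic m (i + 1)) ^ 2 := by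
  calc ∑ h : Fin N, n (t h.castSucc) (t h.succ) ^ 2
      ≤ ∑ h : Fin N, 4 * (1 - l ^ 2)⁻¹ *
          ∑' m, (l⁻¹ ^ 2) ^ m * dyadicSq n m (t h.castSucc) (t h.succ) := by
        refine Finset.sum_le_sum fun h _ => sq_le_tsum_dyadicSq h0 htri hlsc l hl0 hl1
          (ht0.trans (ht.monotone (Fin.zero_le _))) (ht Fin.castSucc_lt_succ)
          ((ht.monotone (Fin.le_last _)).trans ht1)
    _ = 4 * (1 - l ^ 2)⁻¹ * ∑' m, (l⁻¹ ^ 2) ^ m *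
          ∑ h : Fin N, dyadicSq n m (t h.castSucc) (t h.succ) := by
        rw [← Finset.mul_sum, ← tsum_fintype (L := .unconditional _), ENNReal.tsum_comm]
        simp_rw [tsum_fintype, Finset.mul_sum]
    _ ≤ _ := by
        gcongr with m
        exact sum_dyadicSq_le n m ht

/-! ### The square variation of occupation measures -/

/-- The square of the `2`-variation norm of the occupation measure. -/
noncomputable def occVar {d : ℕ} (α : ℝ) (k : ℕ) (a b : ℝ) (w : ℝ → Rd d) : ℝ≥0∞ :=
  ⨆ (n : ℕ) (t : Fin (n + 1) → ℝ) (_ : StrictMono t ∧ t 0 = a ∧ t (Fin.last n) = b),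
    ∑ i : Fin n, occNorm α k w (t i.castSucc) (t i.succ) ^ 2

lemma sum_occNorm_sq_le_liminf {d : ℕ} (α : ℝ) (k : ℕ) {w : ℝ → Rd d} (hw : Measurable w) {n : ℕ}
    {t : Fin (n + 1) → ℝ} (ht : StrictMono t) {σ : ℕ → Fin (n + 1) → ℝ}
    (hσ : Filter.Tendsto σ Filter.atTop (nhds t)) :
    ∑ i : Fin n, occNorm α k w (t i.castSucc) (t i.succ) ^ 2
      ≤ Filter.liminf (fun j => ∑ i : Fin n,
          occNorm α k w (σ j i.castSucc) (σ j i.succ) ^ 2) Filter.atTop := by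
  have hterm : ∀ i : Fin n, occNorm α k w (t i.castSucc) (t i.succ) ^ 2
      ≤ Filter.liminf (fun j => occNorm α k w (σ j i.castSucc) (σ j i.succ) ^ 2)
        Filter.atTop := by
    intro i
    have h1 := occNorm_le_liminf α k hw (ht (Fin.castSucc_lt_succ (i := i)))
      (tendsto_pi_nhds.1 hσ i.castSucc) (tendsto_pi_nhds.1 hσ i.succ)
    have hmono : Monotone fun z : ℝ≥0∞ => z ^ 2 := fun x y h => pow_le_pow_left₀ zero_le h 2
    have h2 := hmono.map_liminf_of_continuousAt (F := Filter.atTop)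
      (fun j => occNorm α k w (σ j i.castSucc) (σ j i.succ))
      (ENNReal.continuous_pow 2).continuousAt
    exact (hmono h1).trans_eq h2
  -- Fatou for counting measure: a finite sum of lower limits is at most the lower limit of the
  -- sums.
  have h := lintegral_liminf_le (u := Filter.atTop) (μ := (Measure.count : Measure (Fin n)))
    (f := fun j i => occNorm α k w (σ j i.castSucc) (σ j i.succ) ^ 2)
    (fun j => measurable_of_finite _)
  simp only [lintegral_count, tsum_fintype] at h
  exact (Finset.sum_le_sum fun i _ => hterm i).trans h

/-- For each number of points, lower semicontinuity reduces the supremum over partitions to a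
countable dense set of them, which does not depend on the path. -/
lemma measurable_occVar {X : Type*} [MeasurableSpace X] {d : ℕ} (α : ℝ) (k : ℕ) (a b : ℝ)
    {W : ℝ → X → Rd d} (hW : Measurable (Function.uncurry W)) :
    Measurable fun x => occVar α k a b fun u => W u x := by
  refine Measurable.iSup fun n => ?_
  set S : Set (Fin (n + 1) → ℝ) := {t | StrictMono t ∧ t 0 = a ∧ t (Fin.last n) = b}
  obtain ⟨D, hDc, hDd⟩ := TopologicalSpace.exists_countable_dense S
  have heq : ∀ x, (⨆ (t : Fin (n + 1) → ℝ)
        (_ : StrictMono t ∧ t 0 = a ∧ t (Fin.last n) = b),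
        ∑ i : Fin n, occNorm α k (fun u => W u x) (t i.castSucc) (t i.succ) ^ 2)
      = ⨆ t ∈ D, ∑ i : Fin n,
          occNorm α k (fun u => W u x) (t.1 i.castSucc) (t.1 i.succ) ^ 2 := by
    intro x
    have hwx : Measurable fun u => W u x := hW.comp measurable_prodMk_right
    refine le_antisymm (iSup₂_le fun t ht => ?_)
      (iSup₂_le fun t _ => le_iSup₂_of_le t.1 t.2 le_rfl)
    obtain ⟨σ, hσD, hσ⟩ := mem_closure_iff_seq_limit.1 (hDd ⟨t, ht⟩)
    refine (sum_occNorm_sq_le_liminf α k hwx ht.1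
      ((continuous_subtype_val.tendsto _).comp hσ)).trans ?_
    refine Filter.liminf_le_of_le (by isBoundedDefault) fun c hc => ?_
    obtain ⟨j, hj⟩ := hc.exists
    exact hj.trans (le_iSup₂_of_le (σ j) (hσD j) le_rfl)
  simp_rw [heq]
  refine Measurable.biSup D hDc fun t _ => Finset.measurable_fun_sum _ fun i _ => ?_
  exact (measurable_occNorm α k hW _ _).pow_const 2

lemma occVar_le_tsum {d : ℕ} (α : ℝ) (k : ℕ) {a b : ℝ} (hab : a < b) {w : ℝ → Rd d}
    (hw : Measurable w) (l : ℝ≥0∞) (hl0 : l ≠ 0) (hl1 : l < 1) :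
    occVar α k a b w ≤ 4 * (1 - l ^ 2)⁻¹ * ∑' m, (l⁻¹ ^ 2) ^ m *
      ∑ i ∈ Finset.range (2 ^ m), occNorm α k w (a + (b - a) * dyadic m i)
        (a + (b - a) * dyadic m (i + 1)) ^ 2 := by
  refine iSup_le fun N => iSup₂_le fun t ht => ?_
  have hba : 0 < b - a := sub_pos.2 hab
  have hmono : ∀ {s t : ℝ}, s ≤ t → a + (b - a) * s ≤ a + (b - a) * t := fun h => by gcongr
  have h := sum_sq_le_tsum_dyadic
    (n := fun s t => occNorm α k w (a + (b - a) * s) (a + (b - a) * t))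
    (fun s t h => occNorm_of_le α k w (hmono h))
    (fun s t u h1 h2 => occNorm_triangle α k hw (hmono h1) (hmono h2))
    (fun s t hst σ τ hσ hτ => occNorm_le_liminf α k hw (by gcongr)
      ((hσ.const_mul _).const_add _) ((hτ.const_mul _).const_add _))
    l hl0 hl1 (t := fun i => (t i - a) / (b - a))
    (fun i j hij => by
      have := ht.1 hij
      simp only
      gcongr)
    (by simp [ht.2.1])
    (by simp [ht.2.2, hba.ne'])
  refine le_trans (le_of_eq (Finset.sum_congr rfl fun i _ => ?_)) h
  simp only [mul_div_cancel₀ _ hba.ne', add_sub_cancel]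

lemma exists_lintegral_occVar_le (d k : ℕ) {a b δ : ℝ} (hab : a < b) (hδ : 0 < δ) :
    ∃ K : ℝ≥0∞, K ≠ ∞ ∧ ∀ (Ω : Type*) [MeasurableSpace Ω] (P : Measure Ω)
      (W : ℝ → Ω → Rd d) (α : ℝ) (M : ℝ≥0∞), Measurable (Function.uncurry W) →
      (∀ s t : ℝ, a ≤ s → s ≤ t → t ≤ b → ∫⁻ x, occNorm α k (fun u => W u x) s t ^ 2 ∂P
        ≤ M * ENNReal.ofReal (t - s) ^ (1 + δ)) →
      ∫⁻ x, occVar α k a b (fun u => W u x) ∂P ≤ K * M := by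
  have hba : 0 < b - a := sub_pos.2 hab
  -- Level `m` contributes `l ^ (-2 * m)` times `2 ^ m` intervals times `2 ^ (-m * (1 + δ))`. With
  -- `l = 2 ^ (-δ / 4)` the product is `l ^ (2 * m)`, which is summable.
  set θ : ℝ := 2 ^ (-(δ / 4)) with hθ
  have hθ0 : 0 < θ := by positivity
  have hθ1 : θ < 1 := Real.rpow_lt_one_of_one_lt_of_neg one_lt_two (by linarith)
  set l := ENNReal.ofReal θ with hl
  have hl0 : l ≠ 0 := by simpa [hl] using hθ0
  have hl1 : l < 1 := by simpa [hl] using hθ1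
  have hl2 : l ^ 2 < 1 := pow_lt_one₀ zero_le hl1 two_ne_zero
  have hc : (1 - l ^ 2)⁻¹ ≠ ∞ := by
    simpa [ENNReal.inv_ne_top, tsub_eq_zero_iff_le] using hl2
  refine ⟨4 * (1 - l ^ 2)⁻¹ * (ENNReal.ofReal (b - a) ^ (1 + δ) * (1 - l ^ 2)⁻¹),
    ENNReal.mul_ne_top (ENNReal.mul_ne_top (by simp) hc) (ENNReal.mul_ne_top
      (ENNReal.rpow_ne_top_of_nonneg (by linarith) ENNReal.ofReal_ne_top) hc),
    fun Ω _ P W α M hW hM => ?_⟩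
  have hmeas := measurable_occNorm (X := Ω) α k hW
  have hlinv : l⁻¹ ^ 2 * 2 * ENNReal.ofReal (1 / 2) ^ (1 + δ) = l ^ 2 := by
    rw [hl, ← ENNReal.ofReal_inv_of_pos hθ0, ← ENNReal.ofReal_pow (by positivity),
      ← ENNReal.ofReal_pow hθ0.le, ENNReal.ofReal_rpow_of_nonneg (by norm_num) (by linarith),
      ← ENNReal.ofReal_ofNat 2, ← ENNReal.ofReal_mul (by positivity),
      ← ENNReal.ofReal_mul (by positivity)]
    congr 1
    have h2 : (1 / 2 : ℝ) ^ (1 + δ) = 2⁻¹ * θ ^ 4 := by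
      rw [one_div, Real.inv_rpow zero_le_two, ← Real.rpow_neg zero_le_two, hθ,
        ← Real.rpow_mul_natCast zero_le_two, ← Real.rpow_neg_one 2, ← Real.rpow_add two_pos]
      congr 1
      push_cast
      ring
    rw [h2]
    field_simp
  have hlevel : ∀ m : ℕ, ∀ i ∈ Finset.range (2 ^ m),
      ∫⁻ x, occNorm α k (fun u => W u x) (a + (b - a) * dyadic m i)
        (a + (b - a) * dyadic m (i + 1)) ^ 2 ∂P
      ≤ M * (ENNReal.ofReal (b - a) ^ (1 + δ) * (ENNReal.ofReal (1 / 2) ^ (1 + δ)) ^ m) := by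
    intro m i hi
    have hi' : ((i + 1 : ℕ) : ℝ) ≤ 2 ^ m := by exact_mod_cast Finset.mem_range.1 hi
    have h0 : 0 ≤ dyadic m i := by unfold dyadic; positivity
    have h1 : dyadic m (i + 1) ≤ 1 := by
      rw [dyadic, div_le_one (by positivity)]
      exact hi'
    have h2 := dyadic_mono m (Nat.le_succ i)
    refine (hM _ _ (by nlinarith) (by gcongr) (by nlinarith)).trans_eq ?_
    congr 1
    have h3 : a + (b - a) * dyadic m (i + 1) - (a + (b - a) * dyadic m i)
        = (b - a) * (1 / 2) ^ m := by
      unfold dyadic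
      push_cast
      rw [one_div, inv_pow]
      ring
    rw [h3, ENNReal.ofReal_mul hba.le, ENNReal.mul_rpow_of_nonneg _ _ (by linarith),
      ENNReal.ofReal_pow (by norm_num), ← ENNReal.rpow_natCast, ← ENNReal.rpow_natCast,
      ← ENNReal.rpow_mul, ← ENNReal.rpow_mul, mul_comm (m : ℝ)]
  calc ∫⁻ x, occVar α k a b (fun u => W u x) ∂P
      ≤ ∫⁻ x, 4 * (1 - l ^ 2)⁻¹ * ∑' m, (l⁻¹ ^ 2) ^ m *
          ∑ i ∈ Finset.range (2 ^ m), occNorm α k (fun u => W u x) (a + (b - a) * dyadic m i)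
            (a + (b - a) * dyadic m (i + 1)) ^ 2 ∂P :=
        lintegral_mono fun x =>
          occVar_le_tsum α k hab (hW.comp measurable_prodMk_right) l hl0 hl1
    _ = 4 * (1 - l ^ 2)⁻¹ * ∑' m, (l⁻¹ ^ 2) ^ m *
          ∑ i ∈ Finset.range (2 ^ m), ∫⁻ x, occNorm α k (fun u => W u x)
            (a + (b - a) * dyadic m i) (a + (b - a) * dyadic m (i + 1)) ^ 2 ∂P := by
        rw [lintegral_const_mul' _ _ (ENNReal.mul_ne_top (by simp) hc),
          lintegral_tsum fun m => Measurable.aemeasurable (by fun_prop)]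
        congr 2 with m
        rw [lintegral_const_mul _ (by fun_prop),
          lintegral_finsetSum _ fun i _ => (hmeas _ _).pow_const 2]
    _ ≤ 4 * (1 - l ^ 2)⁻¹ * ∑' m, (M * ENNReal.ofReal (b - a) ^ (1 + δ)) * (l ^ 2) ^ m := by
        refine mul_le_mul_right (ENNReal.tsum_le_tsum fun m => ?_) _
        refine (mul_le_mul_right (Finset.sum_le_card_nsmul _ _ _ (hlevel m)) _).trans_eq ?_
        rw [Finset.card_range, nsmul_eq_mul, ← hlinv, mul_pow, mul_pow]
        push_cast
        ring
    _ = _ := by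
        rw [ENNReal.tsum_mul_left, ENNReal.tsum_geometric]
        ring

/-- The expected square variation of the occupation measure of a measurable process. -/
lemma exists_lintegral_occVar_le_of_increments (d : ℕ) {a b α β δ : ℝ} (hab : a < b) (hα : 0 < α)
    (hβ : 0 ≤ β) (hδ : 0 < δ) (hδ1 : δ < 1) (hδβ : δ * (β + d) < β - 2 * α)
    (hαN : ∀ n : ℕ, 2 * α ≠ (n : ℝ)) :
    ∃ K : ℝ≥0∞, K ≠ ∞ ∧ ∀ (Ω : Type*) [MeasurableSpace Ω] (P : Measure Ω) [IsProbabilityMeasure P]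
      (W : ℝ → Ω → Rd d) (Cν : ℝ), 0 ≤ Cν → Measurable (Function.uncurry W) →
      IncrementLawBound P a b W β Cν →
      ∫⁻ x, occVar α ⌈α + (d : ℝ) - 1⌉₊ a b (fun u => W u x) ∂P
        ≤ K * (1 + ENNReal.ofReal Cν ^ (1 - δ)) := by
  set k := ⌈α + (d : ℝ) - 1⌉₊
  -- The ceiling gives `≤`. Equality would make `α` a natural number, which `hαN` excludes.
  have hk : α + d < k + 1 := by
    have h1 : α + d - 1 ≤ k := Nat.le_ceil _
    refine lt_of_le_of_ne (by linarith) fun h => ?_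
    have h2 : d ≤ k + 1 := by
      have : (d : ℝ) ≤ (k + 1 : ℕ) := by push_cast; linarith
      exact_mod_cast this
    refine hαN (2 * (k + 1 - d)) ?_
    rw [Nat.cast_mul, Nat.cast_sub h2]
    push_cast
    linarith
  -- Order `k + (d + ⌊β⌋₊)` is high enough for the cancellation. Only the moment bound uses it; the
  -- chaining keeps order `k`.
  obtain ⟨C, hC, hcomp⟩ := exists_occNorm_sq_le_add (d := d) (α := α) (k := k)
    (by positivity) hk (d + ⌊β⌋₊)
  obtain ⟨K₁, hK₁, hmom⟩ := exists_lintegral_occNorm_sq_le d (k + (d + ⌊β⌋₊)) (a := a) (b := b)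
    hα hβ hδ hδ1 hδβ (Nat.le_add_left _ _)
  obtain ⟨K₂, hK₂, hvar⟩ := exists_lintegral_occVar_le d k (δ := δ) hab hδ
  refine ⟨K₂ * (C * K₁), ENNReal.mul_ne_top hK₂ (ENNReal.mul_ne_top hC hK₁),
    fun Ω _ P _ W Cν hCν hW hlaw => ?_⟩
  refine (hvar Ω P W α (C * K₁ * (1 + ENNReal.ofReal Cν ^ (1 - δ))) hW
    fun s t has hst htb => ?_).trans_eq (by ring)
  calc ∫⁻ x, occNorm α k (fun u => W u x) s t ^ 2 ∂P
      ≤ ∫⁻ x, C * occNorm α (k + (d + ⌊β⌋₊)) (fun u => W u x) s t ^ 2 ∂P :=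
        lintegral_mono fun x => hcomp _ (hW.comp measurable_prodMk_right) s t
    _ ≤ C * (K₁ * (1 + ENNReal.ofReal Cν ^ (1 - δ)) * ENNReal.ofReal (t - s) ^ (1 + δ)) := by
        rw [lintegral_const_mul' _ _ hC]
        gcongr
        exact hmom Ω P W Cν hCν hW hlaw s t has hst htb
    _ = _ := by ring

/-! ### Processes with continuous paths -/

/-- A process with almost surely continuous paths has a jointly measurable version with continuous
paths, which agrees with it on `[a, b]` almost surely. -/
lemma exists_continuous_version {Ω : Type*} [MeasurableSpace Ω] {P : Measure Ω} {d : ℕ} {a b : ℝ}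
    (hab : a ≤ b) {ω : ℝ → Ω → Rd d} (hω : IsContinuousProcess P a b ω) :
    ∃ W : ℝ → Ω → Rd d, Measurable (Function.uncurry W) ∧ (∀ x, Continuous fun t => W t x) ∧
      ∀ᵐ x ∂P, ∀ t ∈ Icc a b, W t x = ω t x := by
  classical
  obtain ⟨N, hN, hNm, hN0⟩ := exists_measurable_superset_of_null (ae_iff.1 hω.2)
  -- Time is clamped to `[a, b]`, and the path is set to zero on a measurable null set containing
  -- the discontinuous ones.
  set W : ℝ → Ω → Rd d := fun t => Nᶜ.indicator (ω (projIcc a b hab t))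
  have hcont : ∀ x, Continuous fun t => W t x := by
    intro x
    by_cases hx : x ∈ N
    · have : (fun t => W t x) = fun _ => 0 := by
        ext1 t
        exact indicator_of_notMem (by simpa using hx) _
      rw [this]
      exact continuous_const
    · have : (fun t => W t x) = fun t => ω (projIcc a b hab t) x := by
        ext1 t
        exact indicator_of_mem (by simpa using hx) _
      rw [this]
      have hc : ContinuousOn (fun t => ω t x) (Icc a b) := by
        by_contra h
        exact hx (hN h)
      exact hc.comp_continuous (continuous_subtype_val.comp continuous_projIcc)
        fun t => (projIcc a b hab t).2
  have hmeas : ∀ t, Measurable (W t) := fun t =>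
    (hω.1 _ (projIcc a b hab t).2).indicator hNm.compl
  refine ⟨W, measurable_uncurry_of_continuous_of_measurable hcont hmeas, hcont, ?_⟩
  have hae : ∀ᵐ x ∂P, x ∉ N := measure_eq_zero_iff_ae_notMem.1 hN0
  filter_upwards [hae] with x hx t ht
  simp only [W]
  rw [indicator_of_mem (by simpa using hx), projIcc_of_mem hab ht]

lemma IncrementLawBound.congr {Ω : Type*} [MeasurableSpace Ω] {P : Measure Ω} {d : ℕ}
    {a b β C : ℝ} {ω W : ℝ → Ω → Rd d} (h : IncrementLawBound P a b ω β C)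
    (hW : ∀ᵐ x ∂P, ∀ t ∈ Icc a b, W t x = ω t x) : IncrementLawBound P a b W β C := by
  intro c e hac hce heb
  refine le_trans (le_of_eq ?_) (h c e hac hce heb)
  refine setLIntegral_congr_fun (measurableSet_Icc.prod measurableSet_Icc) fun z hz => ?_
  have : P.map (fun x => W z.2 x - W z.1 x) = P.map fun x => ω z.2 x - ω z.1 x := by
    refine Measure.map_congr ?_
    filter_upwards [hW] with x hx
    rw [hx _ ⟨hac.trans hz.2.1, hz.2.2.trans heb⟩, hx _ ⟨hac.trans hz.1.1, hz.1.2.trans heb⟩]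
  simp only [this]

/-! ### The path of occupation measures -/

lemma occupation_congr {d : ℕ} {w w' : ℝ → Rd d} {s t : ℝ} (h : ∀ u ∈ Ioc s t, w u = w' u) :
    occupation w s t = occupation w' s t := by
  refine Measure.toSignedMeasure_congr (Measure.map_congr ?_)
  filter_upwards [ae_restrict_mem measurableSet_Ioc] with u hu using h u hu

lemma occupation_apply {d : ℕ} {w : ℝ → Rd d} (hw : Measurable w) (s t : ℝ) {A : Set (Rd d)}
    (hA : MeasurableSet A) : occupation w s t A = volume.real (w ⁻¹' A ∩ Ioc s t) := by
  rw [occupation, Measure.toSignedMeasure_apply_measurable hA, map_measureReal_apply hw hA,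
    measureReal_restrict_apply (hw hA)]

lemma occupation_sub {d : ℕ} {w : ℝ → Rd d} (hw : Measurable w) {a s t : ℝ} (has : a ≤ s)
    (hst : s ≤ t) : occupation w a t - occupation w a s = occupation w s t := by
  rw [sub_eq_iff_eq_add]
  refine VectorMeasure.ext fun A hA => ?_
  rw [_root_.add_apply, occupation_apply hw _ _ hA, occupation_apply hw _ _ hA,
    occupation_apply hw _ _ hA, ← Ioc_union_Ioc_eq_Ioc has hst, inter_union_distrib_left,
    measureReal_union _ ((hw hA).inter measurableSet_Ioc)
      (measure_ne_top_of_subset inter_subset_right measure_Ioc_lt_top.ne)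
      (measure_ne_top_of_subset inter_subset_right measure_Ioc_lt_top.ne), add_comm]
  exact (Ioc_disjoint_Ioc_of_le le_rfl).mono inter_subset_right inter_subset_right

lemma hasCompactSupp_occupation {d : ℕ} {w : ℝ → Rd d} (hw : Continuous w) (s t : ℝ) :
    HasCompactSupp (occupation w s t) := by
  refine ⟨w '' Icc s t, isCompact_Icc.image hw, fun A hA hdisj => ?_⟩
  rw [occupation_apply hw.measurable _ _ hA]
  have : w ⁻¹' A ∩ Ioc s t = ∅ := eq_empty_of_forall_notMem fun u hu =>
    disjoint_left.1 hdisj hu.1 ⟨u, Ioc_subset_Icc_self hu.2, rfl⟩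
  simp [this]

lemma variationSBENorm_occupation {d : ℕ} (α : ℝ) {a b : ℝ} {w : ℝ → Rd d} (hw : Measurable w) :
    variationSBENorm 2 α 2 2 a b (fun t => occupation w a t)
      = occVar α ⌈α + (d : ℝ) - 1⌉₊ a b w ^ (1 / 2 : ℝ) := by
  rw [variationSBENorm, variationNorm, occVar]
  congr 1
  refine iSup_congr fun n => iSup_congr fun t => iSup_congr fun ht =>
    Finset.sum_congr rfl fun i _ => ?_
  rw [occupation_sub hw (ht.2.1.symm.le.trans (ht.1.monotone (Fin.zero_le _)))
    (ht.1.monotone (Fin.castSucc_lt_succ (i := i)).le), sbeNorm_occupation α hw,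
    ENNReal.rpow_ofNat]

/-- For `a < t < b` the partition `a < t < b` already contains this term. This yields membership at
every time from finite variation. -/
lemma occNorm_sq_le_occVar {d : ℕ} (α : ℝ) (k : ℕ) {a b t : ℝ} (w : ℝ → Rd d) (hab : a < b)
    (ht : t ∈ Icc a b) : occNorm α k w a t ^ 2 ≤ occVar α k a b w := by
  rcases ht.1.eq_or_lt with rfl | hat
  · rw [occNorm_of_le α k w le_rfl]
    simp
  rcases ht.2.eq_or_lt with rfl | htb
  · have h : StrictMono ![a, t] ∧ ![a, t] 0 = a ∧ ![a, t] (Fin.last 1) = t := by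
      refine ⟨Fin.strictMono_iff_lt_succ.2 fun i => ?_, rfl, rfl⟩
      fin_cases i
      exact hat
    refine le_trans ?_ (le_iSup_of_le 1 (le_iSup₂_of_le ![a, t] h le_rfl))
    simp
  · have h : StrictMono ![a, t, b] ∧ ![a, t, b] 0 = a ∧ ![a, t, b] (Fin.last 2) = b := by
      refine ⟨Fin.strictMono_iff_lt_succ.2 fun i => ?_, rfl, rfl⟩
      fin_cases i
      · exact hat
      · exact htb
    refine le_trans ?_ (le_iSup_of_le 2 (le_iSup₂_of_le ![a, t, b] h le_rfl))
    rw [Fin.sum_univ_two]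
    exact le_self_add

lemma memVariationSBE_occupation {d : ℕ} (α : ℝ) {a b : ℝ} (hab : a < b) {w : ℝ → Rd d}
    (hw : Continuous w) (h : occVar α ⌈α + (d : ℝ) - 1⌉₊ a b w ≠ ∞) :
    MemVariationSBE 2 α 2 2 a b (fun t => occupation w a t) := by
  refine ⟨fun t ht => ⟨hasCompactSupp_occupation hw a t, ?_⟩, ?_⟩
  · rw [sbeNorm_occupation α hw.measurable]
    have := ne_top_of_le_ne_top h (occNorm_sq_le_occVar α _ w hab ht)
    exact (lt_top_iff_ne_top.2 fun h' => this (by rw [h']; simp))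
  · rw [variationSBENorm_occupation α hw.measurable]
    exact ENNReal.rpow_lt_top_of_nonneg (by norm_num) h

lemma lintegral_rpow_le_rpow_lintegral {Ω : Type*} [MeasurableSpace Ω] (P : Measure Ω)
    [IsProbabilityMeasure P] {f : Ω → ℝ≥0∞} (hf : AEMeasurable f P) {p : ℝ} (hp0 : 0 < p)
    (hp1 : p ≤ 1) : ∫⁻ x, f x ^ p ∂P ≤ (∫⁻ x, f x ∂P) ^ p := by
  have h := eLpNorm'_le_eLpNorm'_of_exponent_le hp0 hp1 P hf.aestronglyMeasurable
  simp only [eLpNorm', enorm_eq_self, ENNReal.rpow_one, one_div, inv_one] at h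
  rwa [ENNReal.rpow_inv_le_iff hp0] at h

lemma variationNorm_congr {M : Type*} [AddCommGroup M] (N : M → ℝ≥0∞) (p a b : ℝ) {f g : ℝ → M}
    (h : ∀ t ∈ Icc a b, f t = g t) : variationNorm N p a b f = variationNorm N p a b g := by
  rw [variationNorm, variationNorm]
  congr 1
  refine iSup_congr fun n => iSup_congr fun t => iSup_congr fun ht =>
    Finset.sum_congr rfl fun i _ => ?_
  have hmem : ∀ j, t j ∈ Icc a b := fun j =>
    ⟨ht.2.1.symm.le.trans (ht.1.monotone (Fin.zero_le _)),
      (ht.1.monotone (Fin.le_last _)).trans ht.2.2.le⟩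
  rw [h _ (hmem _), h _ (hmem _)]

/-- Reduction of the occupation measures of a process to those of its continuous version. -/
lemma ae_occupation_eq {Ω : Type*} [MeasurableSpace Ω] {P : Measure Ω} {d : ℕ} {a b : ℝ}
    {ω W : ℝ → Ω → Rd d} (h : ∀ᵐ x ∂P, ∀ t ∈ Icc a b, W t x = ω t x) :
    ∀ᵐ x ∂P, ∀ t ∈ Icc a b,
      occupation (fun r => ω r x) a t = occupation (fun r => W r x) a t := by
  filter_upwards [h] with x hx t ht
  exact occupation_congr fun u hu => (hx u ⟨hu.1.le, hu.2.trans ht.2⟩).symm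

lemma ae_variationSBENorm_eq {Ω : Type*} [MeasurableSpace Ω] {P : Measure Ω} {d : ℕ} (α : ℝ)
    {a b : ℝ} {ω W : ℝ → Ω → Rd d} (hW : Measurable (Function.uncurry W))
    (h : ∀ᵐ x ∂P, ∀ t ∈ Icc a b, W t x = ω t x) :
    ∀ᵐ x ∂P, variationSBENorm 2 α 2 2 a b (fun t => occupation (fun r => ω r x) a t)
      = occVar α ⌈α + (d : ℝ) - 1⌉₊ a b (fun r => W r x) ^ (1 / 2 : ℝ) := by
  filter_upwards [ae_occupation_eq h] with x hx
  have hWx : Measurable fun r => W r x := hW.comp measurable_prodMk_right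
  rw [← variationSBENorm_occupation α hWx]
  exact variationNorm_congr _ _ _ _ hx

end SmallBall

/-! ### The variation of occupation measures of continuous processes -/

theorem theorem4p1 (d : ℕ) (hd : 1 ≤ d) (a b : ℝ) (hab : a < b) (α β : ℝ)
    (hα : 0 < α) (hαβ : α < β / 2) (hαN : ∀ n : ℕ, 2 * α ≠ (n : ℝ)) :
    (∀ (Ω : Type*) [MeasurableSpace Ω] (P : Measure Ω) [IsProbabilityMeasure P]
      (ω : ℝ → Ω → SmallBall.Rd d) (Cν : ℝ), 0 ≤ Cν →
      SmallBall.IsContinuousProcess P a b ω →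
      SmallBall.IncrementLawBound P a b ω β Cν →
      (∀ᵐ x ∂P, SmallBall.MemVariationSBE 2 α 2 2 a b
        (fun t => SmallBall.occupation (fun r => ω r x) a t)) ∧
      AEMeasurable (fun x => SmallBall.variationSBENorm 2 α 2 2 a b
        (fun t => SmallBall.occupation (fun r => ω r x) a t)) P) ∧
    (∀ δ : ℝ, 0 < δ → δ < (β - 2 * α) / (β + 2 * (d : ℝ)) →
      ∀ q : ℝ, 1 ≤ q → q < 2 →
      ∃ K : ℝ, 0 < K ∧
        ∀ (Ω : Type*) [MeasurableSpace Ω] (P : Measure Ω) [IsProbabilityMeasure P]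
          (ω : ℝ → Ω → SmallBall.Rd d) (Cν : ℝ), 0 ≤ Cν →
          SmallBall.IsContinuousProcess P a b ω →
          SmallBall.IncrementLawBound P a b ω β Cν →
          ∫⁻ x, SmallBall.variationSBENorm 2 α 2 2 a b
              (fun t => SmallBall.occupation (fun r => ω r x) a t) ^ q *
            (1 + ⨆ t ∈ Icc a b, ‖ω t x‖ₑ) ^ (-(d : ℝ)) ∂P
            ≤ ENNReal.ofReal (K * (1 + Cν ^ ((1 - δ) * q / 2)))) := by
  have hβ : 0 < β := by linarith
  have hd0 : (0 : ℝ) < d := by exact_mod_cast hd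
  have hδ' : ∀ δ : ℝ, 0 < δ → δ < (β - 2 * α) / (β + 2 * (d : ℝ)) →
      δ < 1 ∧ δ * (β + d) < β - 2 * α := by
    intro δ hδ h
    rw [lt_div_iff₀ (by positivity)] at h
    constructor <;> nlinarith [mul_pos hδ hd0]
  refine ⟨fun Ω _ P _ ω Cν hCν hω hlaw => ?_, fun δ hδ hδδ q hq1 hq2 => ?_⟩
  · have hδ₀ : 0 < (β - 2 * α) / (β + 2 * (d : ℝ)) := div_pos (by linarith) (by positivity)
    -- Any admissible `δ` serves for the qualitative statement; half the threshold is taken.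
    obtain ⟨hδ1, hδβ⟩ := hδ' _ (half_pos hδ₀) (half_lt_self hδ₀)
    obtain ⟨K, hK, hbound⟩ := SmallBall.exists_lintegral_occVar_le_of_increments d hab hα hβ.le
      (half_pos hδ₀) hδ1 hδβ hαN
    obtain ⟨W, hWm, hWc, hWω⟩ := SmallBall.exists_continuous_version hab.le hω
    have hVm := SmallBall.measurable_occVar α ⌈α + (d : ℝ) - 1⌉₊ a b hWm
    have hfin := ne_top_of_le_ne_top (ENNReal.mul_ne_top hK (ENNReal.add_ne_top.2
      ⟨ENNReal.one_ne_top, ENNReal.rpow_ne_top_of_nonneg (by linarith) ENNReal.ofReal_ne_top⟩))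
      (hbound Ω P W Cν hCν hWm (hlaw.congr hWω))
    refine ⟨?_, (hVm.pow_const (1 / 2 : ℝ)).aemeasurable.congr ?_⟩
    · filter_upwards [ae_lt_top hVm hfin, SmallBall.ae_occupation_eq hWω] with x hx hxω
      obtain ⟨h1, h2⟩ := SmallBall.memVariationSBE_occupation α hab (hWc x) hx.ne
      refine ⟨fun t ht => ?_, ?_⟩
      · have := h1 t ht
        simp only at this ⊢
        rwa [hxω t ht]
      · rw [SmallBall.variationSBENorm, SmallBall.variationNorm_congr _ _ _ _ hxω]
        exact h2
    · filter_upwards [SmallBall.ae_variationSBENorm_eq α hWm hWω] with x hx using hx.symm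
  · obtain ⟨hδ1, hδβ⟩ := hδ' δ hδ hδδ
    obtain ⟨K, hK, hbound⟩ := SmallBall.exists_lintegral_occVar_le_of_increments d hab hα hβ.le
      hδ hδ1 hδβ hαN
    have hKq : K ^ (q / 2) ≠ ∞ := ENNReal.rpow_ne_top_of_nonneg (by linarith) hK
    -- The summand 1 only ensures positivity.
    refine ⟨(K ^ (q / 2)).toReal + 1, by positivity, fun Ω _ P _ ω Cν hCν hω hlaw => ?_⟩
    obtain ⟨W, hWm, hWc, hWω⟩ := SmallBall.exists_continuous_version hab.le hω
    have hVm := SmallBall.measurable_occVar α ⌈α + (d : ℝ) - 1⌉₊ a b hWm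
    calc ∫⁻ x, SmallBall.variationSBENorm 2 α 2 2 a b
            (fun t => SmallBall.occupation (fun r => ω r x) a t) ^ q *
            (1 + ⨆ t ∈ Icc a b, ‖ω t x‖ₑ) ^ (-(d : ℝ)) ∂P
        ≤ ∫⁻ x, SmallBall.occVar α ⌈α + (d : ℝ) - 1⌉₊ a b (fun r => W r x) ^ (q / 2) ∂P := by
          refine lintegral_mono_ae ?_
          filter_upwards [SmallBall.ae_variationSBENorm_eq α hWm hWω] with x hx
          rw [hx, ← ENNReal.rpow_mul, show 1 / 2 * q = q / 2 by ring]
          -- The weight has base at least 1 and negative exponent, hence is at most 1.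
          exact mul_le_of_le_one_right' (ENNReal.rpow_le_one_of_one_le_of_neg le_self_add
            (by linarith))
      _ ≤ (∫⁻ x, SmallBall.occVar α ⌈α + (d : ℝ) - 1⌉₊ a b (fun r => W r x) ∂P) ^ (q / 2) :=
          SmallBall.lintegral_rpow_le_rpow_lintegral P hVm.aemeasurable (by linarith)
            (by linarith)
      _ ≤ (K * (1 + ENNReal.ofReal Cν ^ (1 - δ))) ^ (q / 2) := by
          gcongr
          exact hbound Ω P W Cν hCν hWm (hlaw.congr hWω)
      _ ≤ K ^ (q / 2) * (1 + ENNReal.ofReal Cν ^ ((1 - δ) * q / 2)) := by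
          rw [ENNReal.mul_rpow_of_nonneg _ _ (by linarith)]
          gcongr
          refine (ENNReal.rpow_add_le_add_rpow _ _ (by linarith) (by linarith)).trans_eq ?_
          rw [ENNReal.one_rpow, ← ENNReal.rpow_mul, mul_div_assoc]
      _ = ENNReal.ofReal ((K ^ (q / 2)).toReal * (1 + Cν ^ ((1 - δ) * q / 2))) := by
          have hexp : 0 ≤ (1 - δ) * q / 2 :=
            div_nonneg (mul_nonneg (by linarith) (by linarith)) zero_le_two
          rw [ENNReal.ofReal_mul ENNReal.toReal_nonneg, ENNReal.ofReal_toReal hKq,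
            ENNReal.ofReal_add zero_le_one (Real.rpow_nonneg hCν _), ENNReal.ofReal_one,
            ENNReal.ofReal_rpow_of_nonneg hCν hexp]
      _ ≤ _ := by
          refine ENNReal.ofReal_le_ofReal (mul_le_mul_of_nonneg_right (by linarith) ?_)
          exact add_nonneg zero_le_one (Real.rpow_nonneg hCν _)
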